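/- Write a quaternion as $q=q_0+iq_1+jq_2+kq_3$ with modulus $|q|_Q=(q_0^2+q_1^2+q_2^2+q_3^2)^{1/2}$. For $f\in L^1(\mathbb R^2,\mathbb H)$ the two-sided quaternion Fourier transform is $$\mathcal F\{f\}(\xi)=\int_{\mathbb R^2}e^{-i2\pi\xi_1x_1}\,f(x)\,e^{-j2\pi\xi_2x_2}\,dx ,$$ and for $f\in L^2(\mathbb R^2,\mathbb H)$ it is the limit in $L^2$, as $R\to\infty$, of $\mathcal F\{f\,\mathbf 1_{\{|x|\le R\}}\}$. For $f=f_0+if_1+jf_2+kf_3$ with real-valued components $f_m$ put $$\|\mathcal F\{f\}(y)\|_Q=\Big(\sum_{m=0}^{3}|\mathcal F\{f_m\}(y)|_Q^2\Big)^{1/2}.$$ **Theorem 4.2** (Beurling's theorem for the two-sided quaternion Fourier transform). Let $f\in L^2(\mathbb R^2,\mathbb H)$ and let $d\ge 0$ be a real number such that $$\int_{\mathbb R^2}\int_{\mathbb R^2}\frac{|f(x)|_Q\,\|\mathcal F\{f\}(y)\|_Q}{(1+|x|+|y|)^d}\,e^{2\pi|x||y|}\,dx\,dy<\infty .$$ Then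 there are a real number $a>0$ and a polynomial $P$ in two real variables with quaternion coefficients, of degree $<\frac{d-2}{2}$ (the zero polynomial having degree $-\infty$), such that $f(x)=P(x)\,e^{-a|x|^2}$ for almost every $x\in\mathbb R^2$. In particular, $f=0$ almost everywhere when $d\le 2$. -/

import Mathlib

open MeasureTheory Filter Topology
open scoped ENNReal Quaternion

noncomputable section

namespace TwoSidedQFT

/-- The Euclidean plane `ℝ²`. -/
abbrev Plane : Type := EuclideanSpace ℝ (Fin 2)

/-- The quaternion unit `i`. -/
def unitI : ℍ[ℝ] := ⟨0, 1, 0, 0⟩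

/-- The quaternion unit `j`. -/
def unitJ : ℍ[ℝ] := ⟨0, 0, 1, 0⟩

/-- `e^{μθ} = cos θ + μ sin θ`, for a quaternion `μ` with `μ² = -1`. -/
def eulerExp (μ : ℍ[ℝ]) (θ : ℝ) : ℍ[ℝ] := (Real.cos θ : ℍ[ℝ]) + μ * (Real.sin θ : ℍ[ℝ])

/-- The two-sided quaternion Fourier integral
`∫ e^{-i 2π ξ₁ x₁} f(x) e^{-j 2π ξ₂ x₂} dx` of an integrable `f`. -/
def qftIntegral (f : Plane → ℍ[ℝ]) (ξ : Plane) : ℍ[ℝ] :=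
  ∫ x : Plane, eulerExp unitI (-(2 * Real.pi * ξ 0 * x 0)) * f x *
    eulerExp unitJ (-(2 * Real.pi * ξ 1 * x 1))

/-- `g` is the two-sided quaternion Fourier transform of the square integrable function `f`:
it is the limit in `L²`, as `R → ∞`, of the Fourier integrals of the truncations of `f` to
the balls `|x| ≤ R` (these truncations lie in `L¹ ∩ L²`). This determines `g` up to a null set. -/
def IsL2QFT (f g : Plane → ℍ[ℝ]) : Prop :=
  MemLp g 2 volume ∧
    Tendsto
      (fun R : ℝ => eLpNorm
        (fun y => qftIntegral ((Metric.closedBall (0 : Plane) R).indicator f) y - g y) 2 volume)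
      atTop (𝓝 0)

open Classical in
/-- The two-sided quaternion Fourier transform `𝓕{f}` of `f ∈ L²(ℝ², ℍ)`: a representative of
the `L²` limit above, which exists for every `f ∈ L²` by Plancherel's theorem (the value `0`
in the other case is never used for `f ∈ L²`). -/
def qft (f : Plane → ℍ[ℝ]) : Plane → ℍ[ℝ] :=
  if h : ∃ g, IsL2QFT f g then h.choose else 0

/-- The real components `q₀, q₁, q₂, q₃` of `q = q₀ + i q₁ + j q₂ + k q₃`. -/
def component (q : ℍ[ℝ]) (m : Fin 4) : ℝ := ![q.re, q.imI, q.imJ, q.imK] m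

/-- The componentwise modulus `‖𝓕{f}(y)‖_Q = (∑ₘ |𝓕{fₘ}(y)|_Q²)^{1/2}`, where the `fₘ` are the
four real-valued components of `f`. -/
def qftModulus (f : Plane → ℍ[ℝ]) (y : Plane) : ℝ :=
  √(∑ m : Fin 4, ‖qft (fun x => (component (f x) m : ℍ[ℝ])) y‖ ^ 2)

/-- Polynomials in two real variables with quaternion coefficients: the coefficient of
`x₁^p x₂^q` is the value at `(p, q)`. -/
abbrev QuatPoly : Type := (ℕ × ℕ) →₀ ℍ[ℝ]

/-- The value `∑ x₁^p x₂^q c_{p,q}` of a polynomial at a point of the plane. -/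
def QuatPoly.eval (P : QuatPoly) (x : Plane) : ℍ[ℝ] :=
  P.sum fun m c => (x 0 ^ m.1 * x 1 ^ m.2) • c

/-- The total degree of `P` is `< r`: every monomial of `P` has degree `< r` (the zero
polynomial has degree `-∞`). -/
def QuatPoly.DegreeLT (P : QuatPoly) (r : ℝ) : Prop :=
  ∀ m ∈ P.support, ((m.1 + m.2 : ℕ) : ℝ) < r

end TwoSidedQFT

end

/-!
# Beurling's theorem for the two-sided quaternion Fourier transform

Reduction to complex-valued functions. For a real function `u` the two-sided quaternion Fourier
transform at `y` is a real-linear combination of the values of the complex Fourier transform of `u`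
at `y` and at the reflected point `σy = (y₁, -y₂)`, and the square of its modulus is the mean of
`|𝓕u(y)|²` and `|𝓕u(σy)|²` (`qft_ofReal_ae_eq`, `norm_combine_sq`). So `|𝓕fₘ| ≤ √2 ‖𝓕f‖_Q` for each
component `fₘ` of `f`, and Beurling's condition holds for the pair `(|f|, |𝓕fₘ|)`.

Estimates. Let `Fₘ` be the Fourier transform of `e^{-π|x|²} fₘ(x)`, an entire function on `ℂ²`, and
let `M(r) = ∫ |f(x)| e^{-π|x|² + 2πr|x|} dx`. Then `|Fₘ| ≤ M(|Im|)`. On the real plane `Fₘ` is the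
convolution of `𝓕fₘ` with a Gaussian, and completing squares in the exponents turns Beurling's
condition into two facts: `|Fₘ(y)| M(|y|) ≤ C (1 + |y|)^d`
(`exists_norm_gaussFourier_mul_majorant_le`), and `|Fₘ(y)| |Fₘ(iy)| (1 + |y|)^{-d}` is integrable
(`lintegral_gaussFourier_mul_lt_top`).

One complex variable. Let `φ(z) = Fₘ(zω)` for a unit vector `ω`. By the first fact and the
Phragmén–Lindelöf principle in each quadrant, `φ(z) φ(iz)` is a polynomial of degree at most `N =
⌈d⌉` (`exists_polynomial_mul_rotate`). If it is nonzero, removal of the zeros of `φ` and a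
logarithm give `φ(z) = Q(z) e^{-bz²}` (`exists_eq_polynomial_mul_exp`). Comparison of any two
nonzero `φ`'s shows that `b` is a real number `β` independent of `m` and `ω`
(`exponent_eq_of_norm_mul_norm_le`), and the Riemann–Lebesgue lemma gives `β > 0`. (If all `φ`
vanish, `f = 0`.)

Return to the plane. The smooth function `Fₘ(y) e^{β|y|²}` is a polynomial of bounded degree on
each line through the origin, hence a polynomial `Kₘ` (`exists_mvPolynomial_of_lines`). The
Gaussian factors of `Fₘ(y)` and `Fₘ(iy)` cancel, so the second fact says that `|Kₘ(y)| |Kₘ(iy)| (1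
+ |y|)^{-d}` is integrable, which forces `2 deg Kₘ + 2 < d` (`totalDegree_lt_of_lintegral_lt_top`).
By Fourier inversion `e^{-π|x|²} fₘ(x)` is a polynomial of degree at most `deg Kₘ` times
`e^{-π²|x|²/β}`. So `fₘ` is that polynomial times `e^{-a|x|²}` with `a = π²/β - π`, and `a > 0`
because `fₘ` is square integrable.
-/

noncomputable section

open FourierTransform

/-! ### The Fourier transform on `L²` -/

/-- On `L¹ ∩ L²` the Fourier transform defined on `L²` by density is given by the Fourier
integral. -/
theorem fourier_toLp_ae_eq {V : Type*} [NormedAddCommGroup V] [InnerProductSpace ℝ V]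
    [FiniteDimensional ℝ V] [MeasurableSpace V] [BorelSpace V] {u : V → ℂ} (h1 : Integrable u)
    (h2 : MemLp u 2) : ((𝓕 (h2.toLp u) : Lp ℂ 2 (volume : Measure V)) : V → ℂ) =ᵐ[volume] 𝓕 u := by
  have hcont : Continuous (𝓕 u) :=
    VectorFourier.fourierIntegral_continuous Real.continuous_fourierChar
      (by exact continuous_inner) h1
  -- the two functions agree as distributions
  refine ae_eq_of_integral_contDiff_smul_eq
    ((Lp.memLp _).locallyIntegrable (by norm_num)) hcont.locallyIntegrable ?_
  intro g hg hgc
  have hgc' : HasCompactSupport (fun x => (g x : ℂ)) := hgc.comp_left (g := fun t : ℝ => (t : ℂ)) rfl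
  have hg' : ContDiff ℝ ((⊤ : ℕ∞) : WithTop ℕ∞) (fun x => (g x : ℂ)) :=
    Complex.ofRealCLM.contDiff.comp hg
  set φ : SchwartzMap V ℂ := hgc'.toSchwartzMap hg' with hφ
  have hφx : ∀ x, φ x = (g x : ℂ) := fun x => rfl
  have key := congrArg (fun T => T φ) (Lp.fourier_toTemperedDistribution_eq (h2.toLp u))
  simp only [TemperedDistribution.fourier_apply, Lp.toTemperedDistribution_apply] at key
  calc ∫ x, g x • ((𝓕 (h2.toLp u) : Lp ℂ 2 (volume : Measure V)) : V → ℂ) x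
      = ∫ x, φ x • ((𝓕 (h2.toLp u) : Lp ℂ 2 (volume : Measure V)) : V → ℂ) x := by
        simp [hφx]
    _ = ∫ x, (𝓕 φ) x • (h2.toLp u) x := key.symm
    _ = ∫ x, (𝓕 φ) x • u x := by
        refine integral_congr_ae ?_
        filter_upwards [h2.coeFn_toLp] with x hx
        rw [hx]
    _ = ∫ x, φ x • 𝓕 u x := by
        have := VectorFourier.integral_fourierIntegral_smul_eq_flip (μ := (volume : Measure V))
          (ν := (volume : Measure V)) (L := innerₗ V) (f := φ) (g := u)
          Real.continuous_fourierChar (by exact continuous_inner) φ.integrable h1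
        rw [SchwartzMap.fourier_coe]
        rw [flip_innerₗ] at this
        exact this
    _ = ∫ x, g x • 𝓕 u x := by simp [hφx]

/-! ### The two-sided quaternion Fourier transform of real functions -/

namespace TwoSidedQFT

/-- The reflection `(y₁, y₂) ↦ (y₁, -y₂)` of the plane. -/
def reflect : Plane ≃ₗᵢ[ℝ] Plane :=
  LinearIsometryEquiv.piLpCongrRight 2 fun i : Fin 2 =>
    if i = 0 then LinearIsometryEquiv.refl ℝ ℝ else LinearIsometryEquiv.neg ℝ

@[simp] lemma reflect_zero (y : Plane) : reflect y 0 = y 0 := by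
  simp [reflect]

@[simp] lemma reflect_one (y : Plane) : reflect y 1 = - y 1 := by
  simp [reflect]

/-- The real-linear map `ℂ × ℂ → ℍ` which recovers the two-sided quaternion Fourier integral of a
real function `u` at `y` from the values of its complex Fourier integral at `y` and at the
reflected point. -/
def combine : ℂ × ℂ →L[ℝ] ℍ[ℝ] :=
  LinearMap.toContinuousLinearMap
    { toFun := fun p => ⟨(p.1.re + p.2.re) / 2, (p.1.im + p.2.im) / 2, (p.1.im - p.2.im) / 2,
        (p.2.re - p.1.re) / 2⟩
      map_add' := fun p q => by
        ext
        · change (_ + _) / 2 = (_ + _) / 2 + (_ + _) / 2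
          simp only [Prod.fst_add, Prod.snd_add, Complex.add_re]; ring
        · change (_ + _) / 2 = (_ + _) / 2 + (_ + _) / 2
          simp only [Prod.fst_add, Prod.snd_add, Complex.add_im]; ring
        · change (_ - _) / 2 = (_ - _) / 2 + (_ - _) / 2
          simp only [Prod.fst_add, Prod.snd_add, Complex.add_im]; ring
        · change (_ - _) / 2 = (_ - _) / 2 + (_ - _) / 2
          simp only [Prod.fst_add, Prod.snd_add, Complex.add_re]; ring
      map_smul' := fun c p => by
        ext
        · change (_ + _) / 2 = c * ((_ + _) / 2)
          simp only [Prod.smul_fst, Prod.smul_snd, Complex.smul_re, smul_eq_mul]; ring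
        · change (_ + _) / 2 = c * ((_ + _) / 2)
          simp only [Prod.smul_fst, Prod.smul_snd, Complex.smul_im, smul_eq_mul]; ring
        · change (_ - _) / 2 = c * ((_ - _) / 2)
          simp only [Prod.smul_fst, Prod.smul_snd, Complex.smul_im, smul_eq_mul]; ring
        · change (_ - _) / 2 = c * ((_ - _) / 2)
          simp only [Prod.smul_fst, Prod.smul_snd, Complex.smul_re, smul_eq_mul]; ring }

lemma combine_apply (p : ℂ × ℂ) : combine p =
    ⟨(p.1.re + p.2.re) / 2, (p.1.im + p.2.im) / 2, (p.1.im - p.2.im) / 2,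
        (p.2.re - p.1.re) / 2⟩ := rfl

lemma norm_combine_sq (p : ℂ × ℂ) : ‖combine p‖ ^ 2 = (‖p.1‖ ^ 2 + ‖p.2‖ ^ 2) / 2 := by
  rw [sq, ← Quaternion.normSq_eq_norm_mul_self, Quaternion.normSq_def', Complex.sq_norm,
    Complex.sq_norm, Complex.normSq_apply, Complex.normSq_apply, combine_apply]
  ring

lemma norm_combine_le (p : ℂ × ℂ) : ‖combine p‖ ≤ ‖p.1‖ + ‖p.2‖ := by
  have := norm_combine_sq p
  nlinarith [norm_nonneg (combine p), norm_nonneg p.1, norm_nonneg p.2]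

@[simp] lemma re_eulerExp_unitI (θ : ℝ) : (eulerExp unitI θ).re = Real.cos θ := by
  simp [eulerExp, Quaternion.re_mul, show unitI.re = 0 from rfl, show unitI.imI = 1 from rfl,
    show unitI.imJ = 0 from rfl, show unitI.imK = 0 from rfl]

@[simp] lemma imI_eulerExp_unitI (θ : ℝ) : (eulerExp unitI θ).imI = Real.sin θ := by
  simp [eulerExp, Quaternion.imI_mul, show unitI.re = 0 from rfl, show unitI.imI = 1 from rfl,
    show unitI.imJ = 0 from rfl, show unitI.imK = 0 from rfl]

@[simp] lemma imJ_eulerExp_unitI (θ : ℝ) : (eulerExp unitI θ).imJ = 0 := by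
  simp [eulerExp, Quaternion.imJ_mul, show unitI.re = 0 from rfl, show unitI.imI = 1 from rfl,
    show unitI.imJ = 0 from rfl, show unitI.imK = 0 from rfl]

@[simp] lemma imK_eulerExp_unitI (θ : ℝ) : (eulerExp unitI θ).imK = 0 := by
  simp [eulerExp, Quaternion.imK_mul, show unitI.re = 0 from rfl, show unitI.imI = 1 from rfl,
    show unitI.imJ = 0 from rfl, show unitI.imK = 0 from rfl]

@[simp] lemma re_eulerExp_unitJ (θ : ℝ) : (eulerExp unitJ θ).re = Real.cos θ := by
  simp [eulerExp, Quaternion.re_mul, show unitJ.re = 0 from rfl, show unitJ.imI = 0 from rfl,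
    show unitJ.imJ = 1 from rfl, show unitJ.imK = 0 from rfl]

@[simp] lemma imI_eulerExp_unitJ (θ : ℝ) : (eulerExp unitJ θ).imI = 0 := by
  simp [eulerExp, Quaternion.imI_mul, show unitJ.re = 0 from rfl, show unitJ.imI = 0 from rfl,
    show unitJ.imJ = 1 from rfl, show unitJ.imK = 0 from rfl]

@[simp] lemma imJ_eulerExp_unitJ (θ : ℝ) : (eulerExp unitJ θ).imJ = Real.sin θ := by
  simp [eulerExp, Quaternion.imJ_mul, show unitJ.re = 0 from rfl, show unitJ.imI = 0 from rfl,
    show unitJ.imJ = 1 from rfl, show unitJ.imK = 0 from rfl]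

@[simp] lemma imK_eulerExp_unitJ (θ : ℝ) : (eulerExp unitJ θ).imK = 0 := by
  simp [eulerExp, Quaternion.imK_mul, show unitJ.re = 0 from rfl, show unitJ.imI = 0 from rfl,
    show unitJ.imJ = 1 from rfl, show unitJ.imK = 0 from rfl]

/-- The two-sided quaternion Fourier integral of a real function in terms of its complex Fourier
integral. -/
lemma qftIntegral_ofReal {u : Plane → ℝ} (hu : Integrable u) (ξ : Plane) :
    qftIntegral (fun x => (u x : ℍ[ℝ])) ξ =
      combine (𝓕 (fun x => (u x : ℂ)) ξ, 𝓕 (fun x => (u x : ℂ)) (reflect ξ)) := by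
  have hU : Integrable (fun x => (u x : ℂ)) := hu.ofReal
  have hint : ∀ η : Plane, Integrable fun x => Real.fourierChar (-(inner ℝ x η)) • (u x : ℂ) :=
    fun η => (Real.fourierIntegral_convergent_iff η).2 hU
  rw [Real.fourier_eq, Real.fourier_eq, ← integral_pair (hint _) (hint _),
    ← ContinuousLinearMap.integral_comp_comm _ ((hint _).prodMk (hint _)), qftIntegral]
  refine integral_congr_ae (ae_of_all _ fun x => ?_)
  have h1 : inner ℝ x ξ = x 0 * ξ 0 + x 1 * ξ 1 := by
    simp [PiLp.inner_apply, Fin.sum_univ_two, mul_comm]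
  have h2 : inner ℝ x (reflect ξ) = x 0 * ξ 0 - x 1 * ξ 1 := by
    simp [PiLp.inner_apply, Fin.sum_univ_two, mul_comm, sub_eq_add_neg]
  have e1 : ∀ t : ℝ, (Real.fourierChar t : ℂ) =
      ⟨Real.cos (2 * Real.pi * t), Real.sin (2 * Real.pi * t)⟩ := fun t => by
    rw [Real.fourierChar_apply, Complex.exp_mul_I, ← Complex.ofReal_cos, ← Complex.ofReal_sin]
    apply Complex.ext
    · simp [-Complex.ofReal_cos, -Complex.ofReal_sin]
    · simp [-Complex.ofReal_cos, -Complex.ofReal_sin]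
  simp only [h1, h2, Circle.smul_def, e1, combine_apply]
  have ha : 2 * Real.pi * -(x 0 * ξ 0 + x 1 * ξ 1) =
    -(2 * Real.pi * ξ 0 * x 0) + -(2 * Real.pi * ξ 1 * x 1) := by ring
  have hb : 2 * Real.pi * -(x 0 * ξ 0 - x 1 * ξ 1) =
    -(2 * Real.pi * ξ 0 * x 0) - -(2 * Real.pi * ξ 1 * x 1) := by ring
  rw [ha, hb]
  generalize -(2 * Real.pi * ξ 0 * x 0) = a
  generalize -(2 * Real.pi * ξ 1 * x 1) = b
  rw [Real.cos_add, Real.sin_add, Real.cos_sub, Real.sin_sub]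
  ext
  · simp only [Quaternion.re_mul, Quaternion.imI_mul, Quaternion.imJ_mul, Quaternion.imK_mul]
    simp
    ring
  · simp only [Quaternion.re_mul, Quaternion.imI_mul, Quaternion.imJ_mul, Quaternion.imK_mul]
    simp
    ring
  · simp only [Quaternion.re_mul, Quaternion.imI_mul, Quaternion.imJ_mul, Quaternion.imK_mul]
    simp
    ring
  · simp only [Quaternion.re_mul, Quaternion.imI_mul, Quaternion.imJ_mul, Quaternion.imK_mul]
    simp
    ring

/-- The truncations of a square integrable function to balls converge to it in `L²`. -/
lemma tendsto_eLpNorm_indicator_closedBall {u : Plane → ℂ} (hu : MemLp u 2) :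
    Tendsto (fun R : ℝ => eLpNorm ((Metric.closedBall (0 : Plane) R).indicator u - u) 2 volume)
      atTop (𝓝 0) := by
  have h : ∀ R : ℝ, eLpNorm ((Metric.closedBall (0 : Plane) R).indicator u - u) 2 volume =
      (∫⁻ x, ‖((Metric.closedBall (0 : Plane) R).indicator u - u) x‖ₑ ^ (2 : ℝ)) ^ (1 / 2 : ℝ) := by
    intro R
    rw [eLpNorm_eq_lintegral_rpow_enorm_toReal (by norm_num) (by norm_num)]
    norm_num
  simp_rw [h]
  have hlim : Tendsto (fun R : ℝ =>
      ∫⁻ x, ‖((Metric.closedBall (0 : Plane) R).indicator u - u) x‖ₑ ^ (2 : ℝ)) atTop (𝓝 0) := by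
    refine tendsto_of_seq_tendsto fun R hR => ?_
    have := tendsto_lintegral_of_dominated_convergence' (μ := (volume : Measure Plane))
      (f := fun _ => 0)
      (F := fun n x => ‖((Metric.closedBall (0 : Plane) (R n)).indicator u - u) x‖ₑ ^ (2 : ℝ))
      (fun x => ‖u x‖ₑ ^ (2 : ℝ)) ?_ ?_ ?_ ?_
    · simpa [Function.comp_def] using this
    · exact fun n =>
        ((hu.1.indicator measurableSet_closedBall).sub hu.1).enorm.pow_const _
    · refine fun n => ae_of_all _ fun x => ?_
      by_cases hx : x ∈ Metric.closedBall (0 : Plane) (R n) <;> simp [hx]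
    · have := hu.2
      rw [eLpNorm_lt_top_iff_lintegral_rpow_enorm_lt_top (by norm_num) (by norm_num)] at this
      simpa using this.ne
    · refine ae_of_all _ fun x => tendsto_const_nhds.congr' ?_
      filter_upwards [hR.eventually_ge_atTop ‖x‖] with n hn
      have hx : x ∈ Metric.closedBall (0 : Plane) (R n) := by simpa using hn
      simp [hx]
  have := hlim.ennrpow_const (1 / 2 : ℝ)
  simpa using this

lemma integrable_indicator_closedBall {u : Plane → ℂ} (hu : MemLp u 2) (R : ℝ) :
    Integrable ((Metric.closedBall (0 : Plane) R).indicator u) := by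
  rw [integrable_indicator_iff measurableSet_closedBall]
  have : IsFiniteMeasure (volume.restrict (Metric.closedBall (0 : Plane) R)) :=
    ⟨by
      rw [Measure.restrict_apply_univ]
      exact (isCompact_closedBall (0 : Plane) R).measure_lt_top⟩
  exact (hu.restrict _).integrable (by norm_num)

lemma qftIntegral_indicator_ofReal {u : Plane → ℝ} (hu : MemLp (fun x => (u x : ℂ)) 2 volume)
    (R : ℝ) (y : Plane) :
    qftIntegral ((Metric.closedBall (0 : Plane) R).indicator fun x => (u x : ℍ[ℝ])) y =
      combine (𝓕 ((Metric.closedBall (0 : Plane) R).indicator fun x => (u x : ℂ)) y,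
        𝓕 ((Metric.closedBall (0 : Plane) R).indicator fun x => (u x : ℂ)) (reflect y)) := by
  have huR1 := integrable_indicator_closedBall hu R
  set B := Metric.closedBall (0 : Plane) R
  have hind : (B.indicator fun x => (u x : ℂ)) = fun x => ((B.indicator u x : ℝ) : ℂ) := by
    ext x; by_cases hx : x ∈ B <;> simp [hx]
  have hind' : (B.indicator fun x => (u x : ℍ[ℝ])) = fun x => ((B.indicator u x : ℝ) : ℍ[ℝ]) := by
    ext1 x; by_cases hx : x ∈ B <;> simp [hx]
  have huR1' : Integrable (B.indicator u) := by
    have := huR1.re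
    rw [hind] at this
    simpa using this
  rw [hind', qftIntegral_ofReal huR1', ← hind]

lemma continuous_fourier {u : Plane → ℂ} (hu : Integrable u) : Continuous (𝓕 u) :=
  VectorFourier.fourierIntegral_continuous Real.continuous_fourierChar
    (by exact continuous_inner) hu

/-- The quaternion-valued function obtained from the complex `L²` Fourier transform of a real
function is its two-sided quaternion Fourier transform. -/
lemma isL2QFT_combine {u : Plane → ℝ} (hu : MemLp (fun x => (u x : ℂ)) 2 volume) :
    IsL2QFT (fun x => (u x : ℍ[ℝ])) (fun y => combine
      ((𝓕 (hu.toLp _) : Lp ℂ 2 (volume : Measure Plane)) y,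
        (𝓕 (hu.toLp _) : Lp ℂ 2 (volume : Measure Plane)) (reflect y))) := by
  set T : Lp ℂ 2 (volume : Measure Plane) := 𝓕 (hu.toLp _) with hT
  have hmp : MeasurePreserving (reflect : Plane → Plane) volume volume :=
    reflect.measurePreserving
  have hT2 : MemLp (fun y => T (reflect y)) 2 volume := (Lp.memLp T).comp_measurePreserving hmp
  constructor
  · refine MemLp.of_le ((Lp.memLp T).norm.add hT2.norm) ?_ (ae_of_all _ fun y => ?_)
    · exact combine.continuous.comp_aestronglyMeasurable
        ((Lp.memLp T).1.prodMk hT2.1)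
    · refine (norm_combine_le _).trans (le_of_eq ?_)
      simp only [Pi.add_apply]
      rw [Real.norm_of_nonneg (by positivity)]
  · have hlim := tendsto_eLpNorm_indicator_closedBall hu
    have hlim2 := ENNReal.Tendsto.const_mul (a := 2) hlim (Or.inr (by norm_num))
    rw [mul_zero] at hlim2
    refine tendsto_of_tendsto_of_tendsto_of_le_of_le tendsto_const_nhds hlim2
      (fun _ => zero_le) fun R => ?_
    set B := Metric.closedBall (0 : Plane) R
    have huR : MemLp (B.indicator fun x => (u x : ℂ)) 2 volume := hu.indicator measurableSet_closedBall
    have huR1 : Integrable (B.indicator fun x => (u x : ℂ)) := integrable_indicator_closedBall hu R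
    set TR : Lp ℂ 2 (volume : Measure Plane) := 𝓕 (huR.toLp _) with hTR
    have hae : (TR : Plane → ℂ) =ᵐ[volume] 𝓕 (B.indicator fun x => (u x : ℂ)) :=
      fourier_toLp_ae_eq huR1 huR
    have hae2 := hmp.quasiMeasurePreserving.ae hae
    have hnorm : eLpNorm (fun y => TR y - T y) 2 volume =
        eLpNorm (B.indicator (fun x => (u x : ℂ)) - fun x => (u x : ℂ)) 2 volume := by
      have h1 : eLpNorm (fun y => TR y - T y) 2 volume = ‖TR - T‖ₑ := by
        rw [Lp.enorm_def]
        exact eLpNorm_congr_ae (Lp.coeFn_sub TR T).symm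
      have h2 : eLpNorm (B.indicator (fun x => (u x : ℂ)) - fun x => (u x : ℂ)) 2 volume =
          ‖huR.toLp _ - hu.toLp _‖ₑ := by
        rw [← MemLp.toLp_sub, Lp.enorm_toLp]
      rw [h1, h2, hTR, hT, ← ofReal_norm, ← ofReal_norm,
        ← Lp.norm_fourier_eq (huR.toLp _ - hu.toLp _)]
      congr 2
      exact ((Lp.fourierTransformₗᵢ Plane ℂ).map_sub _ _).symm
    calc eLpNorm (fun y => qftIntegral (B.indicator fun x => (u x : ℍ[ℝ])) y -
            combine (T y, T (reflect y))) 2 volume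
        ≤ eLpNorm ((fun y => ‖TR y - T y‖) + (fun y => ‖TR (reflect y) - T (reflect y)‖)) 2
            volume := by
          refine eLpNorm_mono_ae_real ?_
          filter_upwards [hae, hae2] with y h1 h2
          rw [qftIntegral_indicator_ofReal hu R, ← h1, ← h2, ← map_sub]
          exact norm_combine_le _
      _ ≤ eLpNorm (fun y => ‖TR y - T y‖) 2 volume +
            eLpNorm (fun y => ‖TR (reflect y) - T (reflect y)‖) 2 volume := by
          refine eLpNorm_add_le ?_ ?_ (by norm_num)
          · exact ((Lp.memLp TR).1.sub (Lp.memLp T).1).norm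
          · exact (((Lp.memLp TR).comp_measurePreserving hmp).1.sub hT2.1).norm
      _ = 2 * eLpNorm (B.indicator (fun x => (u x : ℂ)) - fun x => (u x : ℂ)) 2 volume := by
          rw [eLpNorm_norm, eLpNorm_norm, two_mul, ← hnorm]
          congr 1
          exact eLpNorm_comp_measurePreserving (g := fun y => TR y - T y)
            ((Lp.memLp TR).1.sub (Lp.memLp T).1) hmp

/-- The two-sided quaternion Fourier transform is unique up to null sets. The measurability of the
transforms of the truncations is what the triangle inequality for `eLpNorm` requires. -/
lemma IsL2QFT.ae_eq {f g g' : Plane → ℍ[ℝ]} (h : IsL2QFT f g) (h' : IsL2QFT f g')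
    (hm : ∀ R : ℝ, AEStronglyMeasurable
      (qftIntegral ((Metric.closedBall (0 : Plane) R).indicator f)) volume) : g =ᵐ[volume] g' := by
  have h0 : eLpNorm (g - g') 2 volume ≤ 0 := by
    have hs := h.2.add h'.2
    rw [add_zero] at hs
    refine ge_of_tendsto' hs fun R => ?_
    have : g - g' = (fun y => qftIntegral ((Metric.closedBall (0 : Plane) R).indicator f) y - g' y)
        - (fun y => qftIntegral ((Metric.closedBall (0 : Plane) R).indicator f) y - g y) := by
      ext1 y; simp
    rw [this, add_comm]
    exact eLpNorm_sub_le ((hm R).sub h'.1.1) ((hm R).sub h.1.1) (by norm_num)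
  have := (eLpNorm_eq_zero_iff (h.1.1.sub h'.1.1) (by norm_num)).1 (le_antisymm h0 zero_le)
  filter_upwards [this] with y hy
  exact sub_eq_zero.1 hy

/-- The transform `qft`, defined by a choice, is given for real functions by the complex `L²`
Fourier transform. -/
lemma qft_ofReal_ae_eq {u : Plane → ℝ} (hu : MemLp (fun x => (u x : ℂ)) 2 volume) :
    qft (fun x => (u x : ℍ[ℝ])) =ᵐ[volume] fun y => combine
      ((𝓕 (hu.toLp _) : Lp ℂ 2 (volume : Measure Plane)) y,
        (𝓕 (hu.toLp _) : Lp ℂ 2 (volume : Measure Plane)) (reflect y)) := by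
  have hex := isL2QFT_combine hu
  have h : ∃ g, IsL2QFT (fun x => (u x : ℍ[ℝ])) g := ⟨_, hex⟩
  have hq : IsL2QFT (fun x => (u x : ℍ[ℝ])) (qft fun x => (u x : ℍ[ℝ])) := by
    rw [qft, dif_pos h]
    exact h.choose_spec
  refine hq.ae_eq hex fun R => Continuous.aestronglyMeasurable ?_
  have hc := continuous_fourier (integrable_indicator_closedBall hu R)
  rw [funext fun y => qftIntegral_indicator_ofReal hu R y]
  exact combine.continuous.comp (hc.prodMk (hc.comp reflect.continuous))

lemma continuous_component (m : Fin 4) : Continuous fun q : ℍ[ℝ] => component q m := by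
  fin_cases m
  · exact Quaternion.continuous_re
  · exact Quaternion.continuous_imI
  · exact Quaternion.continuous_imJ
  · exact Quaternion.continuous_imK

lemma abs_component_le (q : ℍ[ℝ]) (m : Fin 4) : |component q m| ≤ ‖q‖ := by
  refine abs_le_of_sq_le_sq ?_ (norm_nonneg q)
  rw [sq ‖q‖, ← Quaternion.normSq_eq_norm_mul_self, Quaternion.normSq_def']
  fin_cases m <;> simp [component] <;>
    nlinarith [sq_nonneg q.re, sq_nonneg q.imI, sq_nonneg q.imJ, sq_nonneg q.imK]

lemma memLp_component {f : Plane → ℍ[ℝ]} (hf : MemLp f 2 volume) (m : Fin 4) :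
    MemLp (fun x => (component (f x) m : ℂ)) 2 volume := by
  refine hf.of_le ?_ (ae_of_all _ fun x => ?_)
  · exact (Complex.continuous_ofReal.comp (continuous_component m)).comp_aestronglyMeasurable hf.1
  · simpa using abs_component_le (f x) m

/-- The complex `L²` Fourier transforms of the components of `f` are controlled by the
componentwise modulus of its quaternion Fourier transform. -/
lemma norm_fourier_component_le {f : Plane → ℍ[ℝ]} (hf : MemLp f 2 volume) (m : Fin 4) :
    ∀ᵐ y : Plane, ‖(𝓕 ((memLp_component hf m).toLp _) : Lp ℂ 2 (volume : Measure Plane)) y‖ ≤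
      √2 * qftModulus f y := by
  filter_upwards [qft_ofReal_ae_eq (memLp_component hf m)] with y hy
  have h1 : ‖qft (fun x => (component (f x) m : ℍ[ℝ])) y‖ ^ 2 ≤
      ∑ m : Fin 4, ‖qft (fun x => (component (f x) m : ℍ[ℝ])) y‖ ^ 2 :=
    Finset.single_le_sum (f := fun m => ‖qft (fun x => (component (f x) m : ℍ[ℝ])) y‖ ^ 2)
      (fun _ _ => by positivity) (Finset.mem_univ m)
  rw [hy, norm_combine_sq] at h1
  -- `|𝓕u(y)|²` is at most twice the mean of `|𝓕u(y)|²` and `|𝓕u(σy)|²`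
  rw [qftModulus, ← Real.sqrt_mul (by norm_num)]
  refine Real.le_sqrt_of_sq_le ?_
  nlinarith [sq_nonneg ‖(𝓕 ((memLp_component hf m).toLp _) : Lp ℂ 2 (volume : Measure Plane))
    (reflect y)‖]

end TwoSidedQFT

/-! ### Entire functions of one variable -/

open Polynomial in
/-- An entire function of polynomial growth is a polynomial. -/
theorem Complex.exists_polynomial_of_norm_le {f : ℂ → ℂ} (hf : Differentiable ℂ f) {C : ℝ} {N : ℕ}
    (h : ∀ z, ‖f z‖ ≤ C * (1 + ‖z‖) ^ N) :
    ∃ G : ℂ[X], G.natDegree ≤ N ∧ ∀ z, f z = G.eval z := by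
  have hC : 0 ≤ C := by simpa using (norm_nonneg _).trans (h 0)
  -- Cauchy's estimates on large circles
  have hz : ∀ k, N < k → iteratedDeriv k f 0 = 0 := by
    intro k hk
    have hb : ∀ R : ℝ, 1 ≤ R → ‖iteratedDeriv k f 0‖ ≤ k.factorial * C * 2 ^ N * R⁻¹ := by
      intro R hR
      have hR0 : 0 < R := by linarith
      have := Complex.norm_iteratedDeriv_le_of_forall_mem_sphere_norm_le (n := k) (c := 0)
        (C := C * (2 * R) ^ N) hR0 hf.diffContOnCl (fun z hz => (h z).trans (by
          have : ‖z‖ = R := by simpa using hz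
          rw [this]
          gcongr
          linarith))
      refine this.trans ?_
      have h1 : R ^ N / R ^ k ≤ R⁻¹ := by
        rw [div_le_iff₀ (by positivity), ← div_eq_inv_mul, le_div_iff₀ hR0, ← pow_succ]
        exact pow_le_pow_right₀ hR hk
      calc k.factorial * (C * (2 * R) ^ N) / R ^ k
          = k.factorial * C * 2 ^ N * (R ^ N / R ^ k) := by rw [mul_pow]; ring
        _ ≤ _ := by gcongr
    have hl : Tendsto (fun R : ℝ => k.factorial * C * 2 ^ N * R⁻¹) atTop (𝓝 0) := by
      simpa using tendsto_inv_atTop_zero.const_mul ((k.factorial : ℝ) * C * 2 ^ N)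
    have := ge_of_tendsto hl ((eventually_ge_atTop 1).mono hb)
    simpa using le_antisymm this (norm_nonneg _)
  refine ⟨∑ k ∈ Finset.range (N + 1),
    Polynomial.C ((k.factorial : ℂ)⁻¹ * iteratedDeriv k f 0) * X ^ k, ?_, fun z => ?_⟩
  · refine Polynomial.natDegree_sum_le_of_forall_le _ _ fun k hk => ?_
    refine (Polynomial.natDegree_C_mul_X_pow_le _ _).trans ?_
    have := Finset.mem_range.1 hk
    omega
  · rw [← Complex.taylorSeries_eq_of_entire' (c := 0) (z := z) hf,
      tsum_eq_sum (s := Finset.range (N + 1))]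
    · simp [Polynomial.eval_finsetSum]
    · intro k hk
      rw [hz k (by simpa using hk)]
      simp

/-- A point of the closed first quadrant has distance at least `1 + |z|` from `-1 - i`. -/
lemma one_add_norm_le {z : ℂ} (h0 : 0 ≤ z.re) (h1 : 0 ≤ z.im) :
    1 + ‖z‖ ≤ ‖z + (1 + Complex.I)‖ := by
  have h2 : ‖z‖ ≤ z.re + z.im := by
    have := Complex.norm_le_abs_re_add_abs_im z
    rwa [abs_of_nonneg h0, abs_of_nonneg h1] at this
  refine abs_le_of_sq_le_sq' ?_ (norm_nonneg _) |>.2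
  have h3 : ‖z‖ ^ 2 = z.re ^ 2 + z.im ^ 2 := by
    rw [Complex.sq_norm, Complex.normSq_apply]; ring
  rw [Complex.sq_norm (z + _), Complex.normSq_apply]
  simp
  nlinarith

/-- Let `φ₁`, `φ₂` be entire functions of order two which on horizontal lines are controlled by `M`
and on the real axis by `1 / M`, up to a polynomial factor. Then `z ↦ φ₁(z) φ₂(iz)` has polynomial
growth in the first quadrant. On the boundary of the quadrant this is immediate. The quadrant is
exactly too wide for the Phragmén-Lindelöf principle in order two, so it is applied to
`φ₁(e^{-iα} z) φ₂(iz)` in the sector `α ≤ arg z ≤ π/2`, with bounds independent of `α > 0`. -/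
lemma norm_mul_rotate_le {φ₁ φ₂ : ℂ → ℂ} (hd₁ : Differentiable ℂ φ₁) (hd₂ : Differentiable ℂ φ₂)
    {M : ℝ → ℝ} {A B C : ℝ} {N : ℕ} (hB : 0 ≤ B) (hM : MonotoneOn M (Set.Ici 0))
    (hMg : ∀ r, 0 ≤ r → M r ≤ A * Real.exp (B * r ^ 2))
    (h₁ : ∀ z, ‖φ₁ z‖ ≤ M |z.im|) (h₂ : ∀ z, ‖φ₂ z‖ ≤ M |z.im|)
    (h₁' : ∀ r : ℝ, ‖φ₁ r‖ * M |r| ≤ C * (1 + |r|) ^ N)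
    (h₂' : ∀ r : ℝ, ‖φ₂ r‖ * M |r| ≤ C * (1 + |r|) ^ N) {z : ℂ} (hre : 0 ≤ z.re) (him : 0 ≤ z.im) :
    ‖φ₁ z * φ₂ (Complex.I * z)‖ ≤ C * ‖z + (1 + Complex.I)‖ ^ N := by
  have hM0 : ∀ r, 0 ≤ r → 0 ≤ M r := fun r hr => by
    have := (norm_nonneg _).trans (h₁ (r * Complex.I))
    simpa [abs_of_nonneg hr] using this
  have hC : 0 ≤ C := by
    have := (mul_nonneg (norm_nonneg _) (hM0 _ (abs_nonneg _))).trans (h₁' 0)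
    simpa using this
  have hA : 0 ≤ A := by
    have := (hM0 0 le_rfl).trans (hMg 0 le_rfl)
    simpa using this
  have hMle : ∀ (ζ : ℂ) (s : ℝ), ‖ζ‖ ≤ s → M |ζ.im| ≤ M s := fun ζ s hs =>
    hM (Set.mem_Ici.2 (abs_nonneg _)) (Set.mem_Ici.2 ((norm_nonneg ζ).trans hs)) ((Complex.abs_im_le_norm ζ).trans hs)
  have hden : ∀ {ζ : ℂ}, 0 ≤ ζ.re → 0 ≤ ζ.im →
      C * (1 + ‖ζ‖) ^ N ≤ C * ‖ζ + (1 + Complex.I)‖ ^ N := fun h h' => by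
    gcongr
    exact one_add_norm_le h h'
  -- points where the argument of one of the two factors is real
  have hreal₁ : ∀ (r : ℝ) (ζ : ℂ), 0 ≤ r → ‖ζ‖ ≤ r → ‖φ₁ r * φ₂ ζ‖ ≤ C * (1 + r) ^ N := by
    intro r ζ hr hζ
    rw [norm_mul]
    calc ‖φ₁ r‖ * ‖φ₂ ζ‖ ≤ ‖φ₁ r‖ * M r := by
          gcongr
          exact (h₂ ζ).trans (hMle ζ r hζ)
      _ ≤ C * (1 + r) ^ N := by simpa [abs_of_nonneg hr] using h₁' r
  have hreal₂ : ∀ (r : ℝ) (ζ : ℂ), 0 ≤ r → ‖ζ‖ ≤ r →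
      ‖φ₁ ζ * φ₂ ((-r : ℝ) : ℂ)‖ ≤ C * (1 + r) ^ N := by
    intro r ζ hr hζ
    rw [norm_mul, mul_comm]
    calc ‖φ₂ ((-r : ℝ) : ℂ)‖ * ‖φ₁ ζ‖ ≤ ‖φ₂ ((-r : ℝ) : ℂ)‖ * M r := by
          gcongr
          exact (h₁ ζ).trans (hMle ζ r hζ)
      _ ≤ C * (1 + r) ^ N := by simpa [abs_of_nonneg hr] using h₂' (-r)
  rcases him.eq_or_lt with him0 | him0
  · have hz : z = (z.re : ℂ) := by apply Complex.ext <;> simp [← him0]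
    refine le_trans ?_ (hden hre him)
    have h := hreal₁ z.re (Complex.I * z) hre (by
      rw [norm_mul, Complex.norm_I, one_mul, hz]; simp [abs_of_nonneg hre])
    rw [← hz] at h
    have hn : ‖z‖ = z.re := by
      conv_lhs => rw [hz]
      simp [abs_of_nonneg hre]
    rwa [hn]
  have hz0 : z ≠ 0 := fun h => by simp [h] at him0
  set w := Complex.log z with hw
  have hwz : Complex.exp w = z := Complex.exp_log hz0
  have hwim : w.im = Complex.arg z := Complex.log_im z
  have hw0 : 0 < w.im := by
    rw [hwim]
    refine lt_of_le_of_ne (Complex.arg_nonneg_iff.2 him) fun h => ?_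
    have := (Complex.arg_eq_zero_iff.1 h.symm).2
    linarith
  have hw1 : w.im ≤ Real.pi / 2 := by
    rw [hwim]; exact Complex.arg_le_pi_div_two_iff.2 (Or.inl hre)
  have hpos : ∀ ζ : ℂ, 0 ≤ ζ.im → ζ.im ≤ Real.pi / 2 →
      0 ≤ (Complex.exp ζ).re ∧ 0 ≤ (Complex.exp ζ).im := by
    intro ζ h h'
    rw [Complex.exp_re, Complex.exp_im]
    exact ⟨mul_nonneg (Real.exp_pos _).le (Real.cos_nonneg_of_mem_Icc ⟨by linarith, h'⟩),
      mul_nonneg (Real.exp_pos _).le (Real.sin_nonneg_of_nonneg_of_le_pi h (by linarith [Real.pi_pos]))⟩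
  have key : ∀ α : ℝ, 0 < α → α < w.im →
      ‖φ₁ (Complex.exp (w - α * Complex.I)) * φ₂ (Complex.I * z)‖ ≤
        C * ‖z + (1 + Complex.I)‖ ^ N := by
    intro α hα hαw
    -- in the coordinate `ζ = log z` the sector is a strip of width less than `π / 2`
    set g : ℂ → ℂ := fun ζ => φ₁ (Complex.exp (ζ - α * Complex.I)) * φ₂ (Complex.I * Complex.exp ζ) /
      (Complex.exp ζ + (1 + Complex.I)) ^ N with hg
    have hpos' : ∀ ζ : ℂ, α ≤ ζ.im → ζ.im ≤ Real.pi / 2 →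
        1 + ‖Complex.exp ζ‖ ≤ ‖Complex.exp ζ + (1 + Complex.I)‖ := fun ζ h h' =>
      one_add_norm_le (hpos ζ (hα.le.trans h) h').1 (hpos ζ (hα.le.trans h) h').2
    have hne : ∀ ζ : ℂ, α ≤ ζ.im → ζ.im ≤ Real.pi / 2 →
        (Complex.exp ζ + (1 + Complex.I)) ^ N ≠ 0 := fun ζ h h' => by
      refine pow_ne_zero _ (norm_pos_iff.1 (lt_of_lt_of_le ?_ (hpos' ζ h h')))
      positivity
    have hnum : ∀ {ζ : ℂ} {D : ℝ}, α ≤ ζ.im → ζ.im ≤ Real.pi / 2 →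
        ‖φ₁ (Complex.exp (ζ - α * Complex.I)) * φ₂ (Complex.I * Complex.exp ζ)‖ ≤
          D * (1 + ‖Complex.exp ζ‖) ^ N → 0 ≤ D → ‖g ζ‖ ≤ D := by
      intro ζ D h h' h'' hD
      rw [hg]
      simp only
      rw [norm_div, norm_pow, div_le_iff₀ (by
        refine pow_pos (lt_of_lt_of_le ?_ (hpos' ζ h h')) _
        positivity)]
      refine h''.trans ?_
      gcongr
      exact hpos' ζ h h'
    have hgd : DiffContOnCl ℂ g (Complex.im ⁻¹' Set.Ioo α (Real.pi / 2)) := by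
      refine DifferentiableOn.diffContOnCl ?_
      have hcl : closure (Complex.im ⁻¹' Set.Ioo α (Real.pi / 2)) ⊆
          Complex.im ⁻¹' Set.Icc α (Real.pi / 2) :=
        closure_minimal (Set.preimage_mono Set.Ioo_subset_Icc_self)
          (isClosed_Icc.preimage Complex.continuous_im)
      refine DifferentiableOn.mono (fun ζ hζ => ?_) hcl
      refine DifferentiableAt.differentiableWithinAt ?_
      refine DifferentiableAt.div ?_ (by fun_prop) (hne ζ hζ.1 hζ.2)
      fun_prop
    have hgg : ∀ ζ : ℂ, α ≤ ζ.im → ζ.im ≤ Real.pi / 2 →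
        ‖g ζ‖ ≤ A ^ 2 * Real.exp (2 * B * Real.exp (2 * |ζ.re|)) := by
      intro ζ h h'
      refine hnum h h' ?_ (by positivity)
      have e : ∀ {η : ℂ}, ‖η‖ = Real.exp ζ.re → M |η.im| ≤ A * Real.exp (B * Real.exp (2 * |ζ.re|)) := by
        intro η hη
        refine (hMle η _ le_rfl).trans ((hMg _ (norm_nonneg _)).trans ?_)
        rw [hη, ← Real.exp_nat_mul, Nat.cast_ofNat]
        have := le_abs_self ζ.re
        gcongr
      have e1 := (h₁ (Complex.exp (ζ - α * Complex.I))).trans (e (by simp [Complex.norm_exp]))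
      have e2 := (h₂ (Complex.I * Complex.exp ζ)).trans (e (by simp [Complex.norm_exp]))
      rw [norm_mul]
      calc _ ≤ (A * Real.exp (B * Real.exp (2 * |ζ.re|))) * (A * Real.exp (B * Real.exp (2 * |ζ.re|))) := by
            gcongr
        _ = A ^ 2 * Real.exp (2 * B * Real.exp (2 * |ζ.re|)) * 1 := by
            rw [show 2 * B * Real.exp (2 * |ζ.re|) = B * Real.exp (2 * |ζ.re|) + B * Real.exp (2 * |ζ.re|) by ring,
              Real.exp_add]
            ring
        _ ≤ _ := by
            gcongr
            exact one_le_pow₀ (by linarith [norm_nonneg (Complex.exp ζ)])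
    have hfin : ‖g w‖ ≤ C := by
      refine PhragmenLindelof.horizontal_strip hgd ⟨2, ?_, 2 * B, ?_⟩ ?_ ?_ hαw.le hw1
      · rw [lt_div_iff₀ (by linarith)]
        linarith
      · refine Asymptotics.IsBigO.of_bound (A ^ 2) ?_
        refine eventually_inf_principal.2 (Eventually.of_forall fun ζ hζ => ?_)
        rw [Real.norm_of_nonneg (Real.exp_pos _).le]
        exact hgg ζ hζ.1.le hζ.2.le
      · intro ζ hζ
        refine hnum hζ.ge (by linarith) ?_ hC
        have h1 : Complex.exp (ζ - α * Complex.I) = (Real.exp ζ.re : ℝ) := by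
          rw [Complex.ofReal_exp]; congr 1; apply Complex.ext <;> simp [hζ]
        rw [h1, Complex.norm_exp]
        exact hreal₁ _ _ (Real.exp_pos _).le (by simp [Complex.norm_exp])
      · intro ζ hζ
        refine hnum (by linarith) hζ.le ?_ hC
        have h1 : Complex.I * Complex.exp ζ = ((-Real.exp ζ.re : ℝ) : ℂ) := by
          apply Complex.ext
          · simp [Complex.exp_im, hζ, -Complex.ofReal_exp]
          · simp [Complex.exp_re, hζ, -Complex.ofReal_exp]
        rw [h1, Complex.norm_exp]
        exact hreal₂ _ _ (Real.exp_pos _).le (by simp [Complex.norm_exp])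
    rw [hg] at hfin
    simp only at hfin
    rw [hwz, norm_div, norm_pow, div_le_iff₀ (by
        refine pow_pos (lt_of_lt_of_le ?_ (one_add_norm_le hre him)) _
        positivity)] at hfin
    exact hfin
  have hlim : Tendsto (fun α : ℝ => ‖φ₁ (Complex.exp (w - α * Complex.I)) * φ₂ (Complex.I * z)‖)
      (𝓝[>] 0) (𝓝 ‖φ₁ z * φ₂ (Complex.I * z)‖) := by
    have hc : Continuous fun α : ℝ => ‖φ₁ (Complex.exp (w - α * Complex.I)) * φ₂ (Complex.I * z)‖ := by
      have := hd₁.continuous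
      fun_prop
    have := (hc.tendsto 0).mono_left (nhdsWithin_le_nhds (s := Set.Ioi 0))
    simpa [hwz] using this
  refine le_of_tendsto hlim ?_
  filter_upwards [Ioo_mem_nhdsGT hw0] with α hα
  exact key α hα.1 hα.2

open Polynomial in
/-- If an entire function `φ` of order two is controlled by `M` on horizontal lines and by `1 / M`
on the real axis, up to a polynomial factor, then `φ(z) φ(iz)` is a polynomial: the bound in the
first quadrant, applied to the pairs `φ(±z)`, `φ(±z)`, covers all four quadrants. -/
lemma exists_polynomial_mul_rotate {φ : ℂ → ℂ} (hd : Differentiable ℂ φ)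
    {M : ℝ → ℝ} {A B C : ℝ} {N : ℕ} (hB : 0 ≤ B) (hM : MonotoneOn M (Set.Ici 0))
    (hMg : ∀ r, 0 ≤ r → M r ≤ A * Real.exp (B * r ^ 2))
    (h : ∀ z, ‖φ z‖ ≤ M |z.im|) (h' : ∀ r : ℝ, ‖φ r‖ * M |r| ≤ C * (1 + |r|) ^ N) :
    ∃ G : ℂ[X], G.natDegree ≤ N ∧ ∀ z, φ z * φ (Complex.I * z) = G.eval z := by
  have hdn : Differentiable ℂ fun z => φ (-z) := by fun_prop
  have hn : ∀ z, ‖φ (-z)‖ ≤ M |z.im| := fun z => by simpa using h (-z)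
  have hn' : ∀ r : ℝ, ‖φ (-(r : ℂ))‖ * M |r| ≤ C * (1 + |r|) ^ N := fun r => by
    simpa using h' (-r)
  have hC : 0 ≤ C := by
    have h0 : 0 ≤ M |(0 : ℝ)| := by simpa using (norm_nonneg _).trans (h 0)
    have := (mul_nonneg (norm_nonneg _) h0).trans (h' 0)
    simpa using this
  have hfin : ∀ {w z : ℂ} {x : ℝ}, ‖w‖ = ‖z‖ → x ≤ C * ‖w + (1 + Complex.I)‖ ^ N →
      x ≤ C * 2 ^ N * (1 + ‖z‖) ^ N := by
    intro w z x hw hx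
    refine hx.trans ?_
    rw [mul_assoc, ← mul_pow]
    gcongr
    refine (norm_add_le _ _).trans ?_
    have : ‖1 + Complex.I‖ ≤ 2 := (norm_add_le _ _).trans (by norm_num)
    rw [hw]
    linarith [norm_nonneg z]
  refine Complex.exists_polynomial_of_norm_le (C := C * 2 ^ N) (by fun_prop) fun z => ?_
  have hI : Complex.I * Complex.I = -1 := Complex.I_mul_I
  rcases le_total 0 z.re with hre | hre <;> rcases le_total 0 z.im with him | him
  · exact hfin rfl (norm_mul_rotate_le hd hd hB hM hMg h h h' h' hre him)
  · have := norm_mul_rotate_le (z := Complex.I * z) hd hdn hB hM hMg h hn h' hn'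
      (by simpa using him) (by simpa using hre)
    rw [show -(Complex.I * (Complex.I * z)) = z by rw [← mul_assoc, hI]; ring, mul_comm] at this
    exact hfin (by simp) this
  · have := norm_mul_rotate_le (z := -(Complex.I * z)) hdn hd hB hM hMg hn h hn' h'
      (by simpa using him) (by simpa using hre)
    rw [show Complex.I * -(Complex.I * z) = z by rw [mul_neg, ← mul_assoc, hI]; ring, neg_neg,
      mul_comm] at this
    exact hfin (by simp) this
  · have := norm_mul_rotate_le (z := -z) hdn hdn hB hM hMg hn hn hn' hn'
      (by simpa using hre) (by simpa using him)
    rw [neg_neg, show -(Complex.I * -z) = Complex.I * z by ring] at this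
    exact hfin (by simp) this

open Polynomial in
/-- A zero-free entire function `φ` of order two for which `φ(z) φ(iz)` is constant is a
Gaussian: the linear term of its logarithm `h` vanishes because `h(z) + h(iz)` is constant. -/
lemma eq_exp_of_mul_rotate_const {φ : ℂ → ℂ} (hd : Differentiable ℂ φ) {A B : ℝ} (hB : 0 ≤ B)
    (hg : ∀ z, ‖φ z‖ ≤ A * Real.exp (B * ‖z‖ ^ 2)) (h0 : ∀ z, φ z ≠ 0) {c : ℂ}
    (hc : ∀ z, φ z * φ (Complex.I * z) = c) :
    ∃ k b : ℂ, ∀ z, φ z = k * Complex.exp (-(b * z ^ 2)) := by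
  have hA : 0 < A := by
    have := (norm_pos_iff.2 (h0 0)).trans_le (hg 0)
    simpa using this
  -- a holomorphic logarithm `h` of `φ`
  obtain ⟨h, hh0, hh⟩ := (Differentiable.isExactOn_univ (f := fun z => deriv φ z / φ z)
    ((hd.deriv).div hd h0)).with_val_at 0 (Complex.log (φ 0))
  have hhd : Differentiable ℂ h := fun z => (hh z (Set.mem_univ z)).differentiableAt
  have hexp : ∀ z, φ z = Complex.exp (h z) := by
    have hconst : ∀ z, φ z * Complex.exp (-h z) = φ 0 * Complex.exp (-h 0) := by
      intro z
      refine is_const_of_deriv_eq_zero (f := fun z => φ z * Complex.exp (-h z)) (by fun_prop)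
        (fun w => ?_) z 0
      have h1 : HasDerivAt φ (deriv φ w) w := (hd w).hasDerivAt
      have h2 := (h1.mul ((hh w (Set.mem_univ w)).neg.cexp)).deriv
      refine h2.trans ?_
      field_simp [h0 w]
      simp
    intro z
    have := hconst z
    rw [hh0, Complex.exp_neg (Complex.log _), Complex.exp_log (h0 0), mul_inv_cancel₀ (h0 0),
      Complex.exp_neg] at this
    field_simp at this
    exact this
  have hre : ∀ z, (h z).re ≤ |Real.log A| + B * ‖z‖ ^ 2 := by
    intro z
    have := hg z
    rw [hexp, Complex.norm_exp, ← Real.exp_log hA, ← Real.exp_add, Real.exp_le_exp] at this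
    linarith [le_abs_self (Real.log A)]
  -- the upper bound for `Re h` bounds `h`, by the Borel-Carathéodory theorem
  have hgrow : ∀ z, ‖h z‖ ≤ (2 * (|Real.log A| + 1 + 4 * B) + 3 * ‖h 0‖) * (1 + ‖z‖) ^ 2 := by
    intro z
    set R := 2 * (1 + ‖z‖) with hR
    have hRpos : 0 < R := by positivity
    have hMpos : 0 < |Real.log A| + 1 + B * R ^ 2 := by positivity
    have hbc := Complex.borelCaratheodory (f := h) (R := R) (z := z) hMpos
      hhd.differentiableOn (fun w hw => ?_) hRpos (by simp; linarith [norm_nonneg z])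
    · have hz := norm_nonneg z
      have h1 : R - ‖z‖ = ‖z‖ + 2 := by rw [hR]; ring
      have h2 : 2 * (|Real.log A| + 1 + B * R ^ 2) * ‖z‖ / (R - ‖z‖) ≤
          2 * (|Real.log A| + 1 + B * R ^ 2) := by
        rw [div_le_iff₀ (by linarith)]
        gcongr
        linarith
      have h3 : ‖h 0‖ * (R + ‖z‖) / (R - ‖z‖) ≤ 3 * ‖h 0‖ := by
        rw [div_le_iff₀ (by linarith), mul_comm 3, mul_assoc]
        gcongr
        linarith
      have h4 : 1 ≤ (1 + ‖z‖) ^ 2 := one_le_pow₀ (by linarith)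
      refine hbc.trans ((add_le_add h2 h3).trans ?_)
      have h5 : B * R ^ 2 = 4 * B * (1 + ‖z‖) ^ 2 := by rw [hR]; ring
      rw [h5]
      nlinarith [mul_le_mul_of_nonneg_left h4 (abs_nonneg (Real.log A)),
        mul_le_mul_of_nonneg_left h4 (norm_nonneg (h 0))]
    · have hw' : ‖w‖ < R := by simpa using hw
      have : B * ‖w‖ ^ 2 ≤ B * R ^ 2 := by gcongr
      simp only [Set.mem_ofPred_eq]
      linarith [hre w]
  obtain ⟨G, hGd, hG⟩ := Complex.exists_polynomial_of_norm_le hhd hgrow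
  have hG' : ∀ z, h z = G.coeff 0 + G.coeff 1 * z + G.coeff 2 * z ^ 2 := by
    intro z
    rw [hG, Polynomial.eval_eq_sum_range' (n := 3) (by omega)]
    simp [Finset.sum_range_succ]
  -- the linear term of `h(z) + h(iz)` is `(1 + i)` times that of `h`
  have h1 : G.coeff 1 = 0 := by
    set q : ℂ := G.coeff 1 * (1 + Complex.I) with hq
    have hcst : ∀ z, Complex.exp (2 * G.coeff 0 + q * z) = c := by
      intro z
      rw [← hc z, hexp, hexp, ← Complex.exp_add, hG', hG', mul_pow, Complex.I_sq]
      congr 1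
      rw [hq]
      ring
    have hder : HasDerivAt (fun z => Complex.exp (2 * G.coeff 0 + q * z))
        (Complex.exp (2 * G.coeff 0 + q * 0) * q) 0 := by
      have h1 : HasDerivAt (fun z : ℂ => 2 * G.coeff 0 + q * z) q 0 := by
        simpa using ((hasDerivAt_id (0 : ℂ)).const_mul q).const_add (2 * G.coeff 0)
      exact h1.cexp
    have hder0 : HasDerivAt (fun z => Complex.exp (2 * G.coeff 0 + q * z)) 0 0 := by
      rw [funext hcst]; exact hasDerivAt_const 0 c
    have := hder.unique hder0
    have hq0 : q = 0 := by simpa [Complex.exp_ne_zero] using this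
    have hI : (1 + Complex.I) ≠ 0 := fun h => by
      have := congrArg Complex.re h
      simp at this
    simpa [hq, hI] using hq0
  refine ⟨Complex.exp (G.coeff 0), -G.coeff 2, fun z => ?_⟩
  rw [hexp, hG', h1, ← Complex.exp_add]
  congr 1
  ring

open Polynomial in
/-- An entire function `φ` of order two for which `φ(z) φ(iz)` is a nonzero polynomial is the
product of a polynomial and a Gaussian: each zero of `φ` is a zero of the polynomial, and can be
divided out. -/
theorem exists_eq_polynomial_mul_exp {φ : ℂ → ℂ} (hd : Differentiable ℂ φ) {A B : ℝ} (hB : 0 ≤ B)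
    (hg : ∀ z, ‖φ z‖ ≤ A * Real.exp (B * ‖z‖ ^ 2)) {G : ℂ[X]} (hG0 : G ≠ 0)
    (hG : ∀ z, φ z * φ (Complex.I * z) = G.eval z) :
    ∃ (Q : ℂ[X]) (b : ℂ), Q.natDegree ≤ G.natDegree ∧
      ∀ z, φ z = Q.eval z * Complex.exp (-(b * z ^ 2)) := by
  induction hn : G.natDegree using Nat.strong_induction_on generalizing φ G A with
  | _ n ih =>
  by_cases hz : ∀ z, φ z ≠ 0
  · -- a polynomial without zeros is constant
    have hdeg : G.degree = 0 := by
      by_contra h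
      obtain ⟨z, hzr⟩ := IsAlgClosed.exists_root G h
      rw [Polynomial.IsRoot.def, ← hG] at hzr
      exact mul_ne_zero (hz _) (hz _) hzr
    obtain ⟨k, b, h⟩ := eq_exp_of_mul_rotate_const hd hB hg hz (c := G.coeff 0) (fun z => by
      rw [hG, Polynomial.eq_C_of_degree_eq_zero hdeg]; simp)
    exact ⟨Polynomial.C k, b, by simp, fun z => by simp [h z]⟩
  push Not at hz
  obtain ⟨z₀, hz₀⟩ := hz
  have hfac : ∀ z, φ z = (z - z₀) * dslope φ z₀ z := fun z => by
    have := sub_smul_dslope φ z₀ z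
    rw [hz₀, sub_zero, smul_eq_mul] at this
    exact this.symm
  set ψ := dslope φ z₀ with hψ
  have hψd : Differentiable ℂ ψ := by
    rw [← differentiableOn_univ] at hd ⊢
    exact (Complex.differentiableOn_dslope Filter.univ_mem).2 hd
  obtain ⟨G₁, hG₁⟩ : X - C z₀ ∣ G := by
    rw [Polynomial.dvd_iff_isRoot, Polynomial.IsRoot.def, ← hG, hz₀, zero_mul]
  -- identities may be checked off one point
  have hext : ∀ {F₁ F₂ : ℂ → ℂ} (a : ℂ), Continuous F₁ → Continuous F₂ →
      (∀ z, z ≠ a → F₁ z = F₂ z) → ∀ z, F₁ z = F₂ z := by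
    intro F₁ F₂ a h1 h2 h
    have : Set.EqOn F₁ F₂ (closure {a}ᶜ) :=
      Set.EqOn.closure (fun z hz => h z hz) h1 h2
    rw [dense_compl_singleton a |>.closure_eq] at this
    exact fun z => this (Set.mem_univ z)
  have hψc := hψd.continuous
  have h1 : ∀ z, (Complex.I * z - z₀) * (ψ z * ψ (Complex.I * z)) = G₁.eval z := by
    refine hext z₀ (by fun_prop) G₁.continuous fun z hz => ?_
    have := hG z
    rw [hfac z, hfac (Complex.I * z), hG₁] at this
    simp only [eval_mul, eval_sub, eval_X, eval_C] at this
    have hne : z - z₀ ≠ 0 := sub_ne_zero.2 hz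
    apply mul_left_cancel₀ hne
    linear_combination this
  obtain ⟨G₂, hG₂⟩ : X - C (-Complex.I * z₀) ∣ G₁ := by
    rw [Polynomial.dvd_iff_isRoot, Polynomial.IsRoot.def, ← h1]
    rw [show Complex.I * (-Complex.I * z₀) - z₀ = -(Complex.I * Complex.I) * z₀ - z₀ by ring,
      Complex.I_mul_I]
    ring
  have h2 : ∀ z, ψ z * ψ (Complex.I * z) = (C (-Complex.I) * G₂).eval z := by
    refine hext (-Complex.I * z₀) (by fun_prop) (Polynomial.continuous _) fun z hz => ?_
    have := h1 z
    rw [hG₂] at this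
    simp only [eval_mul, eval_sub, eval_X, eval_C] at this ⊢
    have hne : z - -Complex.I * z₀ ≠ 0 := sub_ne_zero.2 hz
    apply mul_left_cancel₀ hne
    have hI := Complex.I_mul_I
    linear_combination -Complex.I * this + (z * ψ z * ψ (Complex.I * z)) * hI
  have hG₂0 : G₂ ≠ 0 := by
    rintro rfl
    exact hG0 (by rw [hG₁, hG₂]; simp)
  have hI0 : C (-Complex.I) ≠ 0 := by simp
  have hdeg : G.natDegree = 2 + G₂.natDegree := by
    rw [hG₁, hG₂, natDegree_mul (X_sub_C_ne_zero _) (mul_ne_zero (X_sub_C_ne_zero _) hG₂0),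
      natDegree_mul (X_sub_C_ne_zero _) hG₂0, natDegree_X_sub_C, natDegree_X_sub_C]
    ring
  have hdeg₂ : (C (-Complex.I) * G₂).natDegree = G₂.natDegree := by
    rw [natDegree_C_mul (by simp)]
  obtain ⟨K, hK⟩ := (isCompact_closedBall z₀ 1).exists_bound_of_continuousOn hψc.continuousOn
  have hK0 : 0 ≤ K := (norm_nonneg _).trans (hK z₀ (by simp))
  have hA : 0 ≤ A := by
    have := (norm_nonneg _).trans (hg 0)
    simpa using this
  -- off the unit disc about `z₀` the division decreases the modulus
  have hψg : ∀ z, ‖ψ z‖ ≤ (A + K) * Real.exp (B * ‖z‖ ^ 2) := by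
    intro z
    have he : 1 ≤ Real.exp (B * ‖z‖ ^ 2) := Real.one_le_exp (by positivity)
    by_cases hzb : z ∈ Metric.closedBall z₀ 1
    · nlinarith [hK z hzb]
    · have hd1 : 1 ≤ ‖z - z₀‖ := by
        rw [Metric.mem_closedBall, dist_eq_norm, not_le] at hzb
        exact hzb.le
      have h := hg z
      rw [hfac z, norm_mul] at h
      nlinarith [norm_nonneg (ψ z)]
  obtain ⟨Q, b, hQ, hQe⟩ := ih _ (by rw [hdeg₂]; omega) hψd hψg (mul_ne_zero hI0 hG₂0) h2 rfl
  refine ⟨(X - C z₀) * Q, b, ?_, fun z => ?_⟩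
  · refine natDegree_mul_le.trans ?_
    rw [natDegree_X_sub_C]
    omega
  · rw [hfac z, hQe z]
    simp [mul_assoc]

open Polynomial in
/-- A nonzero polynomial is bounded away from zero near the end of the real axis. -/
lemma Polynomial.exists_le_norm_eval {P : ℂ[X]} (hP : P ≠ 0) :
    ∃ ε : ℝ, 0 < ε ∧ ∀ᶠ r : ℝ in atTop, ε ≤ ‖P.eval (r : ℂ)‖ := by
  by_cases hd : 0 < P.degree
  · refine ⟨1, one_pos, ?_⟩
    refine (P.tendsto_norm_atTop hd (z := fun r : ℝ => (r : ℂ)) (l := atTop) ?_).eventually_ge_atTop 1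
    simpa using tendsto_abs_atTop_atTop
  · rw [Polynomial.eq_C_of_degree_le_zero (not_lt.1 hd)] at hP ⊢
    refine ⟨‖P.coeff 0‖, ?_, by simp⟩
    rw [norm_pos_iff]
    intro h
    simp [h] at hP

open Polynomial in
/-- Growth comparison of two functions of the form polynomial times Gaussian along the ray through
`s + i`. -/
lemma nonneg_of_norm_mul_norm_le {Q Q' : ℂ[X]} (hQ : Q ≠ 0) (hQ' : Q' ≠ 0) {b b' : ℂ} {C : ℝ} {N : ℕ}
    (h : ∀ z : ℂ, ‖Q.eval z * Complex.exp (-(b * z ^ 2))‖ *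
      ‖Q'.eval (z.im : ℂ) * Complex.exp (-(b' * (z.im : ℂ) ^ 2))‖ ≤ C * (1 + ‖z‖) ^ N) (s : ℝ) :
    0 ≤ (b * (s + Complex.I) ^ 2).re + b'.re := by
  by_contra! hneg
  set c := -((b * (s + Complex.I) ^ 2).re + b'.re) with hc
  have hc0 : 0 < c := by linarith
  set w : ℂ := s + Complex.I with hw
  have hwim : w.im = 1 := by simp [hw]
  have hw0 : w ≠ 0 := fun h => by simp [h] at hwim
  have hQw : Q.comp (Polynomial.C w * X) ≠ 0 := by
    intro h0
    rcases Polynomial.comp_eq_zero_iff.1 h0 with h1 | ⟨-, h1⟩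
    · exact hQ h1
    · have := congrArg (fun p => p.coeff 1) h1
      simp at this
      exact hw0 this
  obtain ⟨ε, hε, h1⟩ := Polynomial.exists_le_norm_eval hQw
  obtain ⟨ε', hε', h2⟩ := Polynomial.exists_le_norm_eval hQ'
  have hC : 0 ≤ C := by
    have := (mul_nonneg (norm_nonneg _) (norm_nonneg _)).trans (h 0)
    simpa using this
  have h3 := (tendsto_exp_mul_div_rpow_atTop (N : ℝ) c hc0).eventually_gt_atTop
    (C * (2 + 2 * ‖w‖) ^ N / (ε * ε'))
  obtain ⟨r, hr1, hr2, hr3, hr⟩ := (h1.and (h2.and (h3.and (eventually_ge_atTop 1)))).exists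
  have hr0 : 0 < r := by linarith
  have him : ((r : ℂ) * w).im = r := by simp [hwim]
  have hz := h (r * w)
  rw [him, norm_mul, norm_mul, Complex.norm_exp, Complex.norm_exp] at hz
  have e1 : (-(b * ((r : ℂ) * w) ^ 2)).re = -((b * w ^ 2).re * r ^ 2) := by
    rw [mul_pow, show b * ((r : ℂ) ^ 2 * w ^ 2) = ((r ^ 2 : ℝ) : ℂ) * (b * w ^ 2) by push_cast; ring,
      Complex.neg_re, Complex.re_ofReal_mul]
    ring
  have e2 : (-(b' * (r : ℂ) ^ 2)).re = -(b'.re * r ^ 2) := by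
    rw [show b' * (r : ℂ) ^ 2 = ((r ^ 2 : ℝ) : ℂ) * b' by push_cast; ring,
      Complex.neg_re, Complex.re_ofReal_mul]
    ring
  have e3 : Q.eval ((r : ℂ) * w) = (Q.comp (Polynomial.C w * X)).eval (r : ℂ) := by
    rw [eval_comp, eval_mul, eval_C, eval_X, mul_comm]
  rw [e1, e2, e3] at hz
  have h4 : ε * ε' * Real.exp (c * r) ≤ C * (2 + 2 * ‖w‖) ^ N * r ^ N := by
    calc ε * ε' * Real.exp (c * r) ≤ ε * ε' * Real.exp (c * r ^ 2) := by
          gcongr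
          nlinarith
      _ = ε * Real.exp (-((b * w ^ 2).re * r ^ 2)) * (ε' * Real.exp (-(b'.re * r ^ 2))) := by
          rw [hc, show -((b * w ^ 2).re + b'.re) * r ^ 2 =
            -((b * w ^ 2).re * r ^ 2) + -(b'.re * r ^ 2) by ring, Real.exp_add]
          ring
      _ ≤ C * (1 + ‖(r : ℂ) * w‖) ^ N := by
          refine le_trans ?_ hz
          gcongr
      _ ≤ C * ((2 + 2 * ‖w‖) * r) ^ N := by
          rw [norm_mul, Complex.norm_real, Real.norm_of_nonneg hr0.le]
          gcongr
          nlinarith [norm_nonneg w]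
      _ = _ := by rw [mul_pow]; ring
  rw [Real.rpow_natCast, div_lt_div_iff₀ (by positivity) (by positivity)] at hr3
  linarith

open Polynomial in
/-- Two functions of the form polynomial times Gaussian, nonzero and each of which compensates the
growth of the other one on horizontal lines, have the same real exponent. -/
lemma exponent_eq_of_norm_mul_norm_le {Q Q' : ℂ[X]} (hQ : Q ≠ 0) (hQ' : Q' ≠ 0) {b b' : ℂ}
    {C : ℝ} {N : ℕ}
    (h : ∀ z : ℂ, ‖Q.eval z * Complex.exp (-(b * z ^ 2))‖ *
      ‖Q'.eval (z.im : ℂ) * Complex.exp (-(b' * (z.im : ℂ) ^ 2))‖ ≤ C * (1 + ‖z‖) ^ N)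
    (h' : ∀ z : ℂ, ‖Q'.eval z * Complex.exp (-(b' * z ^ 2))‖ *
      ‖Q.eval (z.im : ℂ) * Complex.exp (-(b * (z.im : ℂ) ^ 2))‖ ≤ C * (1 + ‖z‖) ^ N) :
    b.im = 0 ∧ b' = b := by
  have e : ∀ (b : ℂ) (s : ℝ), (b * (s + Complex.I) ^ 2).re = b.re * (s ^ 2 - 1) - 2 * s * b.im := by
    intro b s
    simp [pow_two]
    ring
  have k1 : ∀ s : ℝ, 0 ≤ b.re * (s ^ 2 - 1) - 2 * s * b.im + b'.re := fun s => by
    rw [← e]; exact nonneg_of_norm_mul_norm_le hQ hQ' h s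
  have k2 : ∀ s : ℝ, 0 ≤ b'.re * (s ^ 2 - 1) - 2 * s * b'.im + b.re := fun s => by
    rw [← e]; exact nonneg_of_norm_mul_norm_le hQ' hQ h' s
  have hre : b'.re = b.re := by
    have := k1 0
    have := k2 0
    linarith
  -- a quadratic polynomial `p s² - 2 q s` which is nonnegative has `q = 0`
  have hq : ∀ p q : ℝ, (∀ s : ℝ, 0 ≤ p * s ^ 2 - 2 * s * q) → q = 0 := by
    intro p q hs
    by_contra hq0
    have hp : 0 < |p| + 1 := by positivity
    have h1 := hs (q / (|p| + 1))
    have h2 : p * (q / (|p| + 1)) ^ 2 - 2 * (q / (|p| + 1)) * q =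
        q ^ 2 / (|p| + 1) ^ 2 * (p - 2 * (|p| + 1)) := by
      field_simp
    rw [h2] at h1
    have h3 : 0 < q ^ 2 / (|p| + 1) ^ 2 := by positivity
    nlinarith [le_abs_self p, abs_nonneg p]
  have h1 : b.im = 0 := hq b.re b.im fun s => by have := k1 s; rw [hre] at this; linarith
  have h2 : b'.im = 0 := hq b'.re b'.im fun s => by have := k2 s; rw [hre] at this ⊢; linarith
  exact ⟨h1, Complex.ext hre (by rw [h1, h2])⟩

/-! ### The Fourier transform of a function times a Gaussian -/

namespace TwoSidedQFT

lemma integrable_exp_neg_mul_sq {b : ℝ} (hb : 0 < b) :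
    Integrable fun x : Plane => Real.exp (-(b * ‖x‖ ^ 2)) := by
  have h := (GaussianFourier.integrable_cexp_neg_mul_sq_norm_add (V := Plane) (b := (b : ℂ))
    (by simpa using hb) 0 0).norm
  refine h.congr (ae_of_all _ fun x => ?_)
  simp only [Complex.norm_exp]
  congr 1
  simp [← Complex.ofReal_pow]

lemma memLp_exp_neg_mul_sq {b : ℝ} (hb : 0 < b) :
    MemLp (fun x : Plane => Real.exp (-(b * ‖x‖ ^ 2))) 2 := by
  rw [memLp_two_iff_integrable_sq (by fun_prop)]
  refine (integrable_exp_neg_mul_sq (b := 2 * b) (by linarith)).congr (ae_of_all _ fun x => ?_)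
  simp only
  rw [← Real.exp_nat_mul]
  congr 1
  push_cast
  ring

/-- The values on complex multiples `ζ y` of points of the plane of the (entire) Fourier transform
of `e^{-π|x|²} f(x)`. -/
def gaussFourier (f : Plane → ℂ) (ζ : ℂ) (y : Plane) : ℂ :=
  ∫ x : Plane, Complex.exp (-(2 * Real.pi * Complex.I * ζ * (inner ℝ x y : ℝ))) *
    (Real.exp (-(Real.pi * ‖x‖ ^ 2)) * f x)

/-- The majorant `∫ u(x) e^{-π|x|² + 2πr|x|} dx` of the Fourier transform of `e^{-π|x|²} u(x)` on
points with imaginary part of modulus `r`. -/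
def gaussMajorant (u : Plane → ℝ) (r : ℝ) : ℝ :=
  ∫ x : Plane, u x * Real.exp (-(Real.pi * ‖x‖ ^ 2) + 2 * Real.pi * r * ‖x‖)

lemma exp_majorant_le (r s : ℝ) : Real.exp (-(Real.pi * s ^ 2) + 2 * Real.pi * r * s) ≤
    Real.exp (2 * Real.pi * r ^ 2) * Real.exp (-(Real.pi / 2 * s ^ 2)) := by
  rw [← Real.exp_add, Real.exp_le_exp]
  nlinarith [mul_nonneg Real.pi_pos.le (sq_nonneg (s - 2 * r))]

variable {u : Plane → ℝ}

lemma integrable_mul_exp_majorant (hu : MemLp u 2) (r : ℝ) :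
    Integrable fun x : Plane =>
      u x * Real.exp (-(Real.pi * ‖x‖ ^ 2) + 2 * Real.pi * r * ‖x‖) := by
  have h : MemLp (fun x : Plane => Real.exp (-(Real.pi * ‖x‖ ^ 2) + 2 * Real.pi * r * ‖x‖)) 2 := by
    refine ((memLp_exp_neg_mul_sq (b := Real.pi / 2) (by positivity)).const_mul
      (Real.exp (2 * Real.pi * r ^ 2))).of_le (by fun_prop) (ae_of_all _ fun x => ?_)
    rw [Real.norm_of_nonneg (by positivity), Real.norm_of_nonneg (by positivity)]
    exact exp_majorant_le r ‖x‖
  exact hu.integrable_mul h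

lemma gaussMajorant_mono (hu : MemLp u 2) (hu0 : ∀ x, 0 ≤ u x) {r s : ℝ} (h : r ≤ s) :
    gaussMajorant u r ≤ gaussMajorant u s := by
  refine integral_mono (integrable_mul_exp_majorant hu r) (integrable_mul_exp_majorant hu s)
    fun x => ?_
  have := hu0 x
  have := Real.pi_pos
  simp only
  gcongr

lemma gaussMajorant_nonneg (hu0 : ∀ x, 0 ≤ u x) (r : ℝ) : 0 ≤ gaussMajorant u r :=
  integral_nonneg fun x => mul_nonneg (hu0 x) (Real.exp_pos _).le

lemma gaussMajorant_le (hu : MemLp u 2) (hu0 : ∀ x, 0 ≤ u x) (r : ℝ) :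
    gaussMajorant u r ≤
      (∫ x, u x * Real.exp (-(Real.pi / 2 * ‖x‖ ^ 2))) * Real.exp (2 * Real.pi * r ^ 2) := by
  rw [mul_comm, ← integral_const_mul]
  refine integral_mono (integrable_mul_exp_majorant hu r)
    ((hu.integrable_mul (memLp_exp_neg_mul_sq (by positivity))).const_mul _) fun x => ?_
  have := mul_le_mul_of_nonneg_left (exp_majorant_le r ‖x‖) (hu0 x)
  linarith

variable {f : Plane → ℂ}

lemma norm_gaussFourier_integrand_le (hfu : ∀ x, ‖f x‖ ≤ u x) (ζ : ℂ) (x y : Plane) :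
    ‖Complex.exp (-(2 * Real.pi * Complex.I * ζ * (inner ℝ x y : ℝ))) *
      (Real.exp (-(Real.pi * ‖x‖ ^ 2)) * f x)‖ ≤
      u x * Real.exp (-(Real.pi * ‖x‖ ^ 2) + 2 * Real.pi * (|ζ.im| * ‖y‖) * ‖x‖) := by
  have h1 : (-(2 * Real.pi * Complex.I * ζ * (inner ℝ x y : ℝ)) : ℂ).re =
      2 * Real.pi * (ζ.im * inner ℝ x y) := by
    simp
    ring
  have h2 : ζ.im * inner ℝ x y ≤ |ζ.im| * ‖y‖ * ‖x‖ := by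
    refine (le_abs_self _).trans ?_
    rw [abs_mul, mul_assoc, mul_comm ‖y‖]
    gcongr
    exact abs_real_inner_le_norm x y
  rw [norm_mul, norm_mul, Complex.norm_exp, h1, Complex.norm_real,
    Real.norm_of_nonneg (Real.exp_pos _).le, ← mul_assoc, ← Real.exp_add, mul_comm]
  have := Real.pi_pos
  have := (norm_nonneg _).trans (hfu x)
  refine mul_le_mul (hfu x) (Real.exp_le_exp.2 ?_) (Real.exp_pos _).le this
  nlinarith [mul_le_mul_of_nonneg_left h2 (by positivity : (0 : ℝ) ≤ 2 * Real.pi)]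

lemma norm_gaussFourier_le (hu : MemLp u 2) (hfu : ∀ x, ‖f x‖ ≤ u x) (ζ : ℂ) (y : Plane) :
    ‖gaussFourier f ζ y‖ ≤ gaussMajorant u (|ζ.im| * ‖y‖) :=
  norm_integral_le_of_norm_le (integrable_mul_exp_majorant hu _)
    (ae_of_all _ fun x => norm_gaussFourier_integrand_le hfu ζ x y)

lemma aestronglyMeasurable_gaussFourier_integrand (hf : AEStronglyMeasurable f) (ζ : ℂ) (y : Plane) :
    AEStronglyMeasurable fun x : Plane =>
      Complex.exp (-(2 * Real.pi * Complex.I * ζ * (inner ℝ x y : ℝ))) *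
        (Real.exp (-(Real.pi * ‖x‖ ^ 2)) * f x) := by
  refine AEStronglyMeasurable.mul (Continuous.aestronglyMeasurable ?_)
    (AEStronglyMeasurable.mul (Continuous.aestronglyMeasurable ?_) hf)
  · fun_prop
  · fun_prop

lemma differentiable_gaussFourier (hf : AEStronglyMeasurable f) (hu : MemLp u 2)
    (hfu : ∀ x, ‖f x‖ ≤ u x) (y : Plane) : Differentiable ℂ fun ζ => gaussFourier f ζ y := by
  intro ζ₀
  set R : ℝ := ‖ζ₀‖ + 1 with hR
  have key := hasDerivAt_integral_of_dominated_loc_of_deriv_le (μ := (volume : Measure Plane))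
    (F := fun ζ x => Complex.exp (-(2 * Real.pi * Complex.I * ζ * (inner ℝ x y : ℝ))) *
      (Real.exp (-(Real.pi * ‖x‖ ^ 2)) * f x))
    (F' := fun ζ x => -(2 * Real.pi * Complex.I * (inner ℝ x y : ℝ)) *
      (Complex.exp (-(2 * Real.pi * Complex.I * ζ * (inner ℝ x y : ℝ))) *
      (Real.exp (-(Real.pi * ‖x‖ ^ 2)) * f x)))
    (x₀ := ζ₀) (s := Metric.ball ζ₀ 1)
    (bound := fun x => u x * Real.exp (-(Real.pi * ‖x‖ ^ 2) + 2 * Real.pi * ((R + 1) * ‖y‖) * ‖x‖))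
    (Metric.ball_mem_nhds ζ₀ one_pos)
    (Eventually.of_forall fun ζ => aestronglyMeasurable_gaussFourier_integrand hf ζ y)
    ?_ ?_ ?_ (integrable_mul_exp_majorant hu _) ?_
  · exact key.2.differentiableAt
  · exact (integrable_mul_exp_majorant hu _).mono'
      (aestronglyMeasurable_gaussFourier_integrand hf ζ₀ y)
      (ae_of_all _ fun x => norm_gaussFourier_integrand_le hfu ζ₀ x y)
  · exact AEStronglyMeasurable.mul (Continuous.aestronglyMeasurable (by fun_prop))
      (aestronglyMeasurable_gaussFourier_integrand hf ζ₀ y)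
  · refine ae_of_all _ fun x ζ hζ => ?_
    have hζR : |ζ.im| ≤ R := by
      refine (Complex.abs_im_le_norm ζ).trans ?_
      have : ‖ζ - ζ₀‖ < 1 := by simpa [dist_eq_norm] using hζ
      linarith [norm_le_norm_add_norm_sub' ζ ζ₀]
    have h1 := norm_gaussFourier_integrand_le hfu ζ x y
    rw [norm_mul]
    have h2 : ‖(-(2 * Real.pi * Complex.I * (inner ℝ x y : ℝ)) : ℂ)‖ ≤
        Real.exp (2 * Real.pi * ‖y‖ * ‖x‖) := by
      have e : ‖(-(2 * Real.pi * Complex.I * (inner ℝ x y : ℝ)) : ℂ)‖ =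
          2 * Real.pi * |inner ℝ x y| := by
        simp [abs_of_pos Real.pi_pos]
      rw [e]
      have h3 := abs_real_inner_le_norm x y
      have h4 := Real.add_one_le_exp (2 * Real.pi * ‖y‖ * ‖x‖)
      nlinarith [mul_le_mul_of_nonneg_left h3 (by positivity : (0 : ℝ) ≤ 2 * Real.pi)]
    have hux : 0 ≤ u x := (norm_nonneg _).trans (hfu x)
    calc _ ≤ Real.exp (2 * Real.pi * ‖y‖ * ‖x‖) * (u x *
            Real.exp (-(Real.pi * ‖x‖ ^ 2) + 2 * Real.pi * (|ζ.im| * ‖y‖) * ‖x‖)) := by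
          gcongr
      _ = u x * Real.exp (-(Real.pi * ‖x‖ ^ 2) + 2 * Real.pi * ((|ζ.im| + 1) * ‖y‖) * ‖x‖) := by
          rw [mul_left_comm, ← Real.exp_add]
          congr 2
          ring
      _ ≤ _ := by
          have := Real.pi_pos
          gcongr
  · refine ae_of_all _ fun x ζ _ => ?_
    have h1 : HasDerivAt (fun ζ : ℂ => -(2 * Real.pi * Complex.I * ζ * (inner ℝ x y : ℝ)))
        (-(2 * Real.pi * Complex.I * (inner ℝ x y : ℝ))) ζ := by
      have := (((hasDerivAt_id' ζ).const_mul (2 * Real.pi * Complex.I : ℂ)).mul_const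
        ((inner ℝ x y : ℝ) : ℂ)).fun_neg
      simpa using this
    have h2 := h1.cexp.mul_const (Real.exp (-(Real.pi * ‖x‖ ^ 2)) * f x : ℂ)
    refine h2.congr_deriv ?_
    ring

/-- On real points `gaussFourier` is the Fourier integral. -/
lemma gaussFourier_ofReal (t : ℝ) (y : Plane) :
    gaussFourier f t y = 𝓕 (fun x : Plane => (Real.exp (-(Real.pi * ‖x‖ ^ 2)) : ℂ) * f x) (t • y) := by
  rw [Real.fourier_eq', gaussFourier]
  refine integral_congr_ae (ae_of_all _ fun x => ?_)
  simp only [inner_smul_right, smul_eq_mul]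
  congr 2
  push_cast
  ring

/-- By Parseval's identity, multiplication by a Gaussian becomes convolution with a Gaussian. -/
lemma norm_gaussFourier_one_le (hf : MemLp f 2) (y : Plane) :
    ‖gaussFourier f 1 y‖ₑ ≤ ∫⁻ t, ENNReal.ofReal
      (‖(𝓕 (hf.toLp f) : Lp ℂ 2 (volume : Measure Plane)) t‖ * Real.exp (-(Real.pi * ‖y - t‖ ^ 2))) := by
  -- a modulated Gaussian, whose Fourier transform is a translated Gaussian
  set γ : Plane → ℂ := fun x =>
    Complex.exp (-Real.pi * ‖x‖ ^ 2 + 2 * Real.pi * Complex.I * (inner ℝ y x : ℝ)) with hγ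
  have hγn : ∀ x, ‖γ x‖ = Real.exp (-(Real.pi * ‖x‖ ^ 2)) := fun x => by
    rw [hγ, Complex.norm_exp]
    congr 1
    simp [← Complex.ofReal_pow]
  have hγm : AEStronglyMeasurable γ := Continuous.aestronglyMeasurable (by fun_prop)
  have hγ1 : Integrable γ :=
    (integrable_exp_neg_mul_sq Real.pi_pos).mono' hγm (ae_of_all _ fun x => (hγn x).le)
  have hγ2 : MemLp γ 2 := (memLp_exp_neg_mul_sq Real.pi_pos).of_le hγm
    (ae_of_all _ fun x => by rw [hγn]; exact le_abs_self _)
  set T : Lp ℂ 2 (volume : Measure Plane) := 𝓕 (hf.toLp f)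
  have h1 : gaussFourier f 1 y = inner ℂ (hγ2.toLp γ) (hf.toLp f) := by
    rw [L2.inner_def, gaussFourier]
    refine integral_congr_ae ?_
    filter_upwards [hγ2.coeFn_toLp, hf.coeFn_toLp] with x h1 h2
    rw [h1, h2, RCLike.inner_apply', hγ, ← Complex.exp_conj, ← mul_assoc, Complex.ofReal_exp,
      ← Complex.exp_add, real_inner_comm]
    have h2c : (starRingEnd ℂ) 2 = 2 := map_ofNat _ 2
    congr 2
    simp [h2c]
    ring
  have hFγ : ((𝓕 (hγ2.toLp γ) : Lp ℂ 2 (volume : Measure Plane)) : Plane → ℂ) =ᵐ[volume]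
      fun t => (Real.exp (-(Real.pi * ‖y - t‖ ^ 2)) : ℂ) := by
    refine (fourier_toLp_ae_eq hγ1 hγ2).trans (ae_of_all _ fun t => ?_)
    have := fourier_gaussian_innerProductSpace' (b := (Real.pi : ℂ)) (by simpa using Real.pi_pos) y t
    rw [hγ, this]
    have hpi : (Real.pi : ℂ) ≠ 0 := by exact_mod_cast Real.pi_ne_zero
    rw [div_self hpi, Complex.one_cpow, one_mul]
    push_cast
    congr 1
    field_simp
  rw [h1, ← Lp.inner_fourier_eq, L2.inner_def]
  refine (enorm_integral_le_lintegral_enorm _).trans (lintegral_mono_ae ?_)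
  filter_upwards [hFγ] with t ht
  rw [ht, RCLike.inner_apply', ← ofReal_norm]
  refine ENNReal.ofReal_le_ofReal (le_of_eq ?_)
  rw [norm_mul, RCLike.norm_conj, Complex.norm_real, Real.norm_of_nonneg (Real.exp_pos _).le, mul_comm]

/-! ### Consequences of Beurling's condition -/

lemma one_add_rpow_mul_exp_le {d w : ℝ} (hd : 0 ≤ d) (hw : 0 ≤ w) :
    (1 + w) ^ d * Real.exp (-(Real.pi * w ^ 2)) ≤ Real.exp (d ^ 2 / 4) * Real.exp (-(w ^ 2)) := by
  have h1 : (1 + w) ^ d ≤ Real.exp (d * w) := by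
    calc (1 + w) ^ d ≤ (Real.exp w) ^ d := by
          gcongr
          linarith [Real.add_one_le_exp w]
      _ = Real.exp (d * w) := by rw [← Real.exp_mul, mul_comm]
  calc _ ≤ Real.exp (d * w) * Real.exp (-(Real.pi * w ^ 2)) := by gcongr
    _ = Real.exp (d * w - Real.pi * w ^ 2) := by rw [← Real.exp_add]; congr 1
    _ ≤ Real.exp (d ^ 2 / 4 + -(w ^ 2)) := by
        rw [Real.exp_le_exp]
        nlinarith [sq_nonneg (d / 2 - w), Real.pi_gt_three, sq_nonneg w]
    _ = _ := Real.exp_add _ _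

/-- The weight `e^{2π|x||y|} / (1 + |x| + |y|)^d` of Beurling's condition. -/
def beurlingWeight (d : ℝ) (x y : Plane) : ℝ :=
  Real.exp (2 * Real.pi * ‖x‖ * ‖y‖) / (1 + ‖x‖ + ‖y‖) ^ d

lemma beurlingWeight_nonneg (d : ℝ) (x y : Plane) : 0 ≤ beurlingWeight d x y := by
  unfold beurlingWeight; positivity

lemma measurable_beurlingWeight (d : ℝ) :
    Measurable fun p : Plane × Plane => beurlingWeight d p.1 p.2 := by
  unfold beurlingWeight
  fun_prop

/-- The kernel bound behind the pointwise estimate. With `τ = |t|`, `ρ = |x|`, `r = |y|` the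
identity `-π(r - τ)² - πρ² + 2πrρ = 2πτρ - π(r - τ - ρ)²` produces the weight. -/
lemma kernel_pointwise_le {d : ℝ} (hd : 0 ≤ d) (x t y : Plane) :
    Real.exp (-(Real.pi * ‖y - t‖ ^ 2)) *
      Real.exp (-(Real.pi * ‖x‖ ^ 2) + 2 * Real.pi * ‖y‖ * ‖x‖) ≤
      Real.exp (d ^ 2 / 4) * (1 + ‖y‖) ^ d * beurlingWeight d x t := by
  set w := |‖y‖ - ‖t‖ - ‖x‖| with hw
  have hw0 : 0 ≤ w := abs_nonneg _
  have hs : 1 + ‖x‖ + ‖t‖ ≤ (1 + ‖y‖) * (1 + w) := by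
    have := neg_abs_le (‖y‖ - ‖t‖ - ‖x‖)
    rw [← hw] at this
    nlinarith [norm_nonneg y]
  have hpow : (1 + ‖x‖ + ‖t‖) ^ d ≤ (1 + ‖y‖) ^ d * (1 + w) ^ d := by
    rw [← Real.mul_rpow (by positivity) (by positivity)]
    gcongr
  have hexp : Real.exp (-(Real.pi * ‖y - t‖ ^ 2)) *
      Real.exp (-(Real.pi * ‖x‖ ^ 2) + 2 * Real.pi * ‖y‖ * ‖x‖) ≤
      Real.exp (2 * Real.pi * ‖x‖ * ‖t‖) * Real.exp (-(Real.pi * w ^ 2)) := by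
    rw [← Real.exp_add, ← Real.exp_add, Real.exp_le_exp, hw, sq_abs]
    have h1 : (‖y‖ - ‖t‖) ^ 2 ≤ ‖y - t‖ ^ 2 :=
      sq_le_sq.2 (by rw [abs_of_nonneg (norm_nonneg (y - t))]; exact abs_norm_sub_norm_le y t)
    nlinarith [mul_le_mul_of_nonneg_left h1 Real.pi_pos.le]
  have hk : (1 + w) ^ d * Real.exp (-(Real.pi * w ^ 2)) ≤ Real.exp (d ^ 2 / 4) := by
    refine (one_add_rpow_mul_exp_le hd hw0).trans ?_
    have : Real.exp (-(w ^ 2)) ≤ 1 := Real.exp_le_one_iff.2 (by nlinarith)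
    nlinarith [Real.exp_pos (d ^ 2 / 4)]
  unfold beurlingWeight
  rw [mul_div_assoc', le_div_iff₀ (by positivity)]
  calc _ ≤ (Real.exp (2 * Real.pi * ‖x‖ * ‖t‖) * Real.exp (-(Real.pi * w ^ 2))) *
        ((1 + ‖y‖) ^ d * (1 + w) ^ d) := by gcongr
    _ = ((1 + w) ^ d * Real.exp (-(Real.pi * w ^ 2))) * (1 + ‖y‖) ^ d *
        Real.exp (2 * Real.pi * ‖x‖ * ‖t‖) := by ring
    _ ≤ _ := by gcongr

/-- The kernel bound behind the integrated estimate. The Gaussian in `y - (t + x)` on the right-hand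
side keeps the variable `y` integrable; it comes from the identity
`-|y - t|² - |x|² + 2⟨x, y⟩ = 2⟨x, t⟩ - |y - (t + x)|²`, where `2⟨x, t⟩` is less than `2|x||t|` by
`(|x| + |t|)² - |x + t|²`. -/
lemma kernel_integrated_le {d : ℝ} (hd : 0 ≤ d) (x t y : Plane) :
    Real.exp (-(Real.pi * ‖y - t‖ ^ 2)) *
      Real.exp (-(Real.pi * ‖x‖ ^ 2) + 2 * Real.pi * inner ℝ x y) / (1 + ‖y‖) ^ d ≤
      Real.exp (d ^ 2 / 4) ^ 2 * beurlingWeight d x t * Real.exp (-‖y - (t + x)‖ ^ 2) := by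
  set v := t + x with hv
  set a := ‖y - v‖ with ha
  set b := ‖x‖ + ‖t‖ - ‖v‖ with hb
  have ha0 : 0 ≤ a := norm_nonneg _
  have hb0 : 0 ≤ b := by
    have := norm_add_le t x
    rw [← hv] at this
    linarith
  have hs : 1 + ‖x‖ + ‖t‖ ≤ (1 + ‖y‖) * ((1 + a) * (1 + b)) := by
    have h1 : ‖v‖ ≤ ‖y‖ + a := by
      have := norm_sub_le y (y - v)
      simpa using this
    have h2 : 1 + ‖x‖ + ‖t‖ ≤ 1 + ‖y‖ + a + b := by linarith
    have := norm_nonneg y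
    have h3 : 0 ≤ a * b := by positivity
    nlinarith [mul_nonneg this (by positivity : 0 ≤ a + b + a * b)]
  have hpow : (1 + ‖x‖ + ‖t‖) ^ d ≤ (1 + ‖y‖) ^ d * ((1 + a) ^ d * (1 + b) ^ d) := by
    rw [← Real.mul_rpow (by positivity) (by positivity), ← Real.mul_rpow (by positivity) (by positivity)]
    gcongr
  have hexp : Real.exp (-(Real.pi * ‖y - t‖ ^ 2)) *
      Real.exp (-(Real.pi * ‖x‖ ^ 2) + 2 * Real.pi * inner ℝ x y) ≤
      Real.exp (2 * Real.pi * ‖x‖ * ‖t‖) * (Real.exp (-(Real.pi * a ^ 2)) *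
        Real.exp (-(Real.pi * b ^ 2))) := by
    rw [← Real.exp_add, ← Real.exp_add, ← Real.exp_add, Real.exp_le_exp]
    have h1 : a ^ 2 = ‖y - t‖ ^ 2 - 2 * (inner ℝ x y - inner ℝ x t) + ‖x‖ ^ 2 := by
      rw [ha, hv, ← sub_sub, norm_sub_sq_real (y - t) x, ← inner_sub_right, real_inner_comm]
    have h2 : ‖v‖ ^ 2 = ‖t‖ ^ 2 + 2 * inner ℝ x t + ‖x‖ ^ 2 := by
      rw [hv, norm_add_sq_real, real_inner_comm]
    -- `b² ≤ (|x| + |t|)² - |v|²` since `|v| ≤ |x| + |t|`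
    have h3 : b ^ 2 ≤ (‖x‖ + ‖t‖) ^ 2 - ‖v‖ ^ 2 := by
      have : 0 ≤ ‖v‖ := norm_nonneg v
      nlinarith
    have h4 : -‖y - t‖ ^ 2 - ‖x‖ ^ 2 + 2 * inner ℝ x y ≤ 2 * (‖x‖ * ‖t‖) - a ^ 2 - b ^ 2 := by
      nlinarith
    nlinarith [mul_le_mul_of_nonneg_left h4 Real.pi_pos.le]
  have hka := one_add_rpow_mul_exp_le hd ha0
  have hkb : (1 + b) ^ d * Real.exp (-(Real.pi * b ^ 2)) ≤ Real.exp (d ^ 2 / 4) := by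
    refine (one_add_rpow_mul_exp_le hd hb0).trans ?_
    have : Real.exp (-(b ^ 2)) ≤ 1 := Real.exp_le_one_iff.2 (by nlinarith)
    nlinarith [Real.exp_pos (d ^ 2 / 4)]
  rw [div_le_iff₀ (by positivity)]
  unfold beurlingWeight
  rw [mul_div_assoc', div_mul_eq_mul_div, div_mul_eq_mul_div, le_div_iff₀ (by positivity)]
  calc _ ≤ (Real.exp (2 * Real.pi * ‖x‖ * ‖t‖) * (Real.exp (-(Real.pi * a ^ 2)) *
        Real.exp (-(Real.pi * b ^ 2)))) * ((1 + ‖y‖) ^ d * ((1 + a) ^ d * (1 + b) ^ d)) := by gcongr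
    _ = ((1 + a) ^ d * Real.exp (-(Real.pi * a ^ 2))) *
        ((1 + b) ^ d * Real.exp (-(Real.pi * b ^ 2))) * Real.exp (2 * Real.pi * ‖x‖ * ‖t‖) *
          (1 + ‖y‖) ^ d := by ring
    _ ≤ (Real.exp (d ^ 2 / 4) * Real.exp (-(a ^ 2))) * Real.exp (d ^ 2 / 4) *
        Real.exp (2 * Real.pi * ‖x‖ * ‖t‖) * (1 + ‖y‖) ^ d := by gcongr
    _ = _ := by ring

variable {v : Plane → ℝ} {d : ℝ}

/-- Beurling's condition for a pair of nonnegative functions. -/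
def BeurlingCondition (d : ℝ) (u v : Plane → ℝ) : Prop :=
  ∫⁻ t : Plane, ∫⁻ x : Plane, ENNReal.ofReal (u x * v t * beurlingWeight d x t) < ∞

/-- On the real plane the Fourier transform of `e^{-π|x|²} f(x)` decays at least as fast as the
majorant grows, up to a polynomial factor. -/
lemma exists_norm_gaussFourier_mul_majorant_le (hd : 0 ≤ d) (hf : MemLp f 2) (hu : MemLp u 2)
    (hum : Measurable u) (hu0 : ∀ x, 0 ≤ u x)
    (hv : v = fun t => ‖(𝓕 (hf.toLp f) : Lp ℂ 2 (volume : Measure Plane)) t‖)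
    (hB : BeurlingCondition d u v) :
    ∃ C : ℝ, ∀ y, ‖gaussFourier f 1 y‖ * gaussMajorant u ‖y‖ ≤ C * (1 + ‖y‖) ^ d := by
  have hvm : Measurable v := by
    rw [hv]; exact (Lp.stronglyMeasurable _).norm.measurable
  have hv0 : ∀ t, 0 ≤ v t := fun t => by rw [hv]; exact norm_nonneg _
  set I := ∫⁻ t : Plane, ∫⁻ x : Plane, ENNReal.ofReal (u x * v t * beurlingWeight d x t) with hI
  refine ⟨Real.exp (d ^ 2 / 4) * I.toReal, fun y => ?_⟩
  have hM : ENNReal.ofReal (gaussMajorant u ‖y‖) = ∫⁻ x, ENNReal.ofReal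
      (u x * Real.exp (-(Real.pi * ‖x‖ ^ 2) + 2 * Real.pi * ‖y‖ * ‖x‖)) :=
    ofReal_integral_eq_lintegral_ofReal (integrable_mul_exp_majorant hu _)
      (ae_of_all _ fun x => mul_nonneg (hu0 x) (Real.exp_pos _).le)
  have h1 : ENNReal.ofReal (‖gaussFourier f 1 y‖ * gaussMajorant u ‖y‖) ≤
      ENNReal.ofReal (Real.exp (d ^ 2 / 4) * (1 + ‖y‖) ^ d) * I := by
    rw [ENNReal.ofReal_mul (norm_nonneg _), ofReal_norm]
    refine (mul_le_mul_left (norm_gaussFourier_one_le hf y) _).trans ?_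
    rw [hM, ← lintegral_mul_const _ (by fun_prop), hI, ← lintegral_const_mul _ ?_]
    · refine lintegral_mono fun t => ?_
      rw [← lintegral_const_mul _ (by fun_prop), ← lintegral_const_mul _ ?_]
      · refine lintegral_mono fun x => ?_
        simp only
        rw [← ENNReal.ofReal_mul (by positivity), ← ENNReal.ofReal_mul (by positivity)]
        refine ENNReal.ofReal_le_ofReal ?_
        have h := mul_le_mul_of_nonneg_left (kernel_pointwise_le hd x t y)
          (mul_nonneg (hu0 x) (hv0 t))
        have hvt : ‖(𝓕 (hf.toLp f) : Lp ℂ 2 (volume : Measure Plane)) t‖ = v t := by rw [hv]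
        rw [hvt]
        calc _ = u x * v t * (Real.exp (-(Real.pi * ‖y - t‖ ^ 2)) *
              Real.exp (-(Real.pi * ‖x‖ ^ 2) + 2 * Real.pi * ‖y‖ * ‖x‖)) := by ring
          _ ≤ _ := h
          _ = _ := by ring
      · have := (measurable_beurlingWeight d).comp (measurable_id.prodMk (measurable_const (a := t)))
        exact ((hum.mul_const _).mul this).ennreal_ofReal
    · refine Measurable.lintegral_prod_right' (f := fun p : Plane × Plane =>
        ENNReal.ofReal (u p.2 * v p.1 * beurlingWeight d p.2 p.1)) ?_
      exact (((hum.comp measurable_snd).mul (hvm.comp measurable_fst)).mul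
        ((measurable_beurlingWeight d).comp measurable_swap)).ennreal_ofReal
  have hIfin : I ≠ ∞ := hB.ne
  have h2 := ENNReal.toReal_mono (ENNReal.mul_ne_top ENNReal.ofReal_ne_top hIfin) h1
  rw [ENNReal.toReal_ofReal (mul_nonneg (norm_nonneg _) (gaussMajorant_nonneg hu0 _)),
    ENNReal.toReal_mul, ENNReal.toReal_ofReal (by positivity)] at h2
  linarith

/-- The product of the values at `y` and `i y` of the Fourier transform of `e^{-π|x|²} f(x)` is
integrable over the real plane against `(1 + |y|)^{-d}`. -/
lemma lintegral_gaussFourier_mul_lt_top (hd : 0 ≤ d) (hf : MemLp f 2) (hum : Measurable u)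
    (hfu : ∀ x, ‖f x‖ ≤ u x)
    (hv : v = fun t => ‖(𝓕 (hf.toLp f) : Lp ℂ 2 (volume : Measure Plane)) t‖)
    (hB : BeurlingCondition d u v) :
    ∫⁻ y : Plane, ENNReal.ofReal
      (‖gaussFourier f 1 y‖ * ‖gaussFourier f Complex.I y‖ / (1 + ‖y‖) ^ d) < ∞ := by
  have hvm : Measurable v := by
    rw [hv]; exact (Lp.stronglyMeasurable _).norm.measurable
  have hv0 : ∀ t, 0 ≤ v t := fun t => by rw [hv]; exact norm_nonneg _
  have hu0 : ∀ x, 0 ≤ u x := fun x => (norm_nonneg _).trans (hfu x)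
  set μ : Measure (Plane × Plane) := (volume : Measure Plane).prod (volume : Measure Plane)
  set F : Plane × Plane → ℝ≥0∞ := fun p =>
    ENNReal.ofReal (u p.2 * v p.1 * beurlingWeight d p.2 p.1) with hF
  have hFm : Measurable F := (((hum.comp measurable_snd).mul (hvm.comp measurable_fst)).mul
        ((measurable_beurlingWeight d).comp measurable_swap)).ennreal_ofReal
  have hFint : ∫⁻ p, F p ∂μ < ∞ := by
    rw [lintegral_prod _ hFm.aemeasurable]
    exact hB
  set K := ∫⁻ w : Plane, ENNReal.ofReal (Real.exp (-(1 * ‖w‖ ^ 2))) with hK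
  have hKfin : K < ∞ := (integrable_exp_neg_mul_sq one_pos).lintegral_lt_top
  have hpt : ∀ y : Plane, ENNReal.ofReal
      (‖gaussFourier f 1 y‖ * ‖gaussFourier f Complex.I y‖ / (1 + ‖y‖) ^ d) ≤
      ∫⁻ p, ENNReal.ofReal (Real.exp (d ^ 2 / 4) ^ 2) * (F p *
        ENNReal.ofReal (Real.exp (-(1 * ‖y - (p.1 + p.2)‖ ^ 2)))) ∂μ := by
    intro y
    have h1 : ‖gaussFourier f Complex.I y‖ₑ ≤ ∫⁻ x, ENNReal.ofReal
        (u x * Real.exp (-(Real.pi * ‖x‖ ^ 2) + 2 * Real.pi * inner ℝ x y)) := by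
      refine (enorm_integral_le_lintegral_enorm _).trans (lintegral_mono fun x => ?_)
      rw [← ofReal_norm]
      refine ENNReal.ofReal_le_ofReal ?_
      have e : (-(2 * Real.pi * Complex.I * Complex.I * (inner ℝ x y : ℝ)) : ℂ) =
          ((2 * Real.pi * inner ℝ x y : ℝ) : ℂ) := by
        push_cast
        linear_combination (-2 * (Real.pi : ℂ) * (inner ℝ x y : ℝ)) * Complex.I_mul_I
      rw [e, norm_mul, norm_mul, Complex.norm_exp, Complex.ofReal_re, Complex.norm_real,
        Real.norm_of_nonneg (Real.exp_pos _).le, ← mul_assoc, ← Real.exp_add, mul_comm, add_comm]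
      gcongr
      exact hfu x
    calc ENNReal.ofReal (‖gaussFourier f 1 y‖ * ‖gaussFourier f Complex.I y‖ / (1 + ‖y‖) ^ d)
        = ‖gaussFourier f 1 y‖ₑ * ‖gaussFourier f Complex.I y‖ₑ *
            ENNReal.ofReal ((1 + ‖y‖) ^ d)⁻¹ := by
          rw [div_eq_mul_inv, ENNReal.ofReal_mul (by positivity), ENNReal.ofReal_mul (norm_nonneg _),
            ofReal_norm, ofReal_norm]
      _ ≤ (∫⁻ t, ENNReal.ofReal (v t * Real.exp (-(Real.pi * ‖y - t‖ ^ 2)))) *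
            (∫⁻ x, ENNReal.ofReal
              (u x * Real.exp (-(Real.pi * ‖x‖ ^ 2) + 2 * Real.pi * inner ℝ x y))) *
            ENNReal.ofReal ((1 + ‖y‖) ^ d)⁻¹ := by
          gcongr
          rw [hv]
          exact norm_gaussFourier_one_le hf y
      _ = ∫⁻ p, ENNReal.ofReal (v p.1 * Real.exp (-(Real.pi * ‖y - p.1‖ ^ 2))) *
            ENNReal.ofReal (u p.2 * Real.exp (-(Real.pi * ‖p.2‖ ^ 2) +
              2 * Real.pi * inner ℝ p.2 y)) * ENNReal.ofReal ((1 + ‖y‖) ^ d)⁻¹ ∂μ := by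
          rw [lintegral_mul_const _ (by fun_prop), ← lintegral_prod_mul (by fun_prop) (by fun_prop)]
      _ ≤ _ := by
          refine lintegral_mono fun p => ?_
          simp only [hF]
          have h0 : 0 ≤ u p.2 := hu0 _
          have h0' : 0 ≤ v p.1 := hv0 _
          have hw0 := beurlingWeight_nonneg d p.2 p.1
          rw [← ENNReal.ofReal_mul (by positivity), ← ENNReal.ofReal_mul (by positivity),
            ← ENNReal.ofReal_mul (by positivity), ← ENNReal.ofReal_mul (by positivity)]
          refine ENNReal.ofReal_le_ofReal ?_
          have h := mul_le_mul_of_nonneg_left (kernel_integrated_le hd p.2 p.1 y)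
            (mul_nonneg h0 h0')
          rw [one_mul]
          calc _ = u p.2 * v p.1 * (Real.exp (-(Real.pi * ‖y - p.1‖ ^ 2)) *
              Real.exp (-(Real.pi * ‖p.2‖ ^ 2) + 2 * Real.pi * inner ℝ p.2 y) /
                (1 + ‖y‖) ^ d) := by ring
            _ ≤ _ := h
            _ = _ := by ring
  refine (lintegral_mono hpt).trans_lt ?_
  rw [lintegral_lintegral_swap]
  · calc _ = ∫⁻ p, ENNReal.ofReal (Real.exp (d ^ 2 / 4) ^ 2) * (F p * K) ∂μ := by
          refine lintegral_congr fun p => ?_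
          rw [lintegral_const_mul _ (by fun_prop), lintegral_const_mul _ (by fun_prop), hK]
          congr 2
          exact lintegral_sub_right_eq_self
            (fun w : Plane => ENNReal.ofReal (Real.exp (-(1 * ‖w‖ ^ 2)))) (p.1 + p.2)
      _ = ENNReal.ofReal (Real.exp (d ^ 2 / 4) ^ 2) * ((∫⁻ p, F p ∂μ) * K) := by
          rw [lintegral_const_mul _ (by fun_prop), lintegral_mul_const _ hFm]
      _ < ∞ := ENNReal.mul_lt_top ENNReal.ofReal_lt_top (ENNReal.mul_lt_top hFint hKfin)
  · have : Measurable fun q : Plane × (Plane × Plane) =>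
        ENNReal.ofReal (Real.exp (-(1 * ‖q.1 - (q.2.1 + q.2.2)‖ ^ 2))) := by fun_prop
    exact (((hFm.comp measurable_snd).mul this).const_mul _).aemeasurable

end TwoSidedQFT

/-! ### Polynomials on the plane -/

open Polynomial in
lemma Polynomial.iteratedDeriv_eval_ofReal (Q : ℂ[X]) (k : ℕ) :
    iteratedDeriv k (fun t : ℝ => Q.eval (t : ℂ)) = fun t : ℝ => ((derivative^[k]) Q).eval (t : ℂ) := by
  induction k with
  | zero => simp
  | succ k ih =>
    rw [iteratedDeriv_succ, ih, Function.iterate_succ_apply']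
    ext t
    exact ((Polynomial.hasDerivAt _ _).comp_ofReal).deriv

open Polynomial in
lemma Polynomial.iteratedDeriv_eval_ofReal_zero (Q : ℂ[X]) (k : ℕ) :
    iteratedDeriv k (fun t : ℝ => Q.eval (t : ℂ)) 0 = k.factorial * Q.coeff k := by
  rw [Polynomial.iteratedDeriv_eval_ofReal]
  simp only [Complex.ofReal_zero]
  rw [← Polynomial.coeff_zero_eq_eval_zero, Polynomial.coeff_iterate_derivative]
  simp [Nat.descFactorial_self]

namespace TwoSidedQFT

/-- A smooth function on the plane which is a polynomial of bounded degree on every line through the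
origin is a polynomial: it equals the sum of the homogeneous terms of its Taylor series. -/
theorem exists_mvPolynomial_of_lines {K : Plane → ℂ} (hK : ContDiff ℝ (⊤ : ℕ∞) K) (N : ℕ)
    (h : ∀ y, ∃ Q : Polynomial ℂ, Q.natDegree ≤ N ∧ ∀ t : ℝ, K (t • y) = Q.eval (t : ℂ)) :
    ∃ P : MvPolynomial (Fin 2) ℂ, ∀ y : Plane, K y = P.eval fun j => (y j : ℂ) := by
  set e : Fin 2 → Plane := fun j => EuclideanSpace.single j 1 with he
  refine ⟨∑ k ∈ Finset.range (N + 1), MvPolynomial.C ((k.factorial : ℂ)⁻¹) *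
    ∑ r : Fin k → Fin 2, MvPolynomial.C (iteratedFDeriv ℝ k K 0 fun i => e (r i)) *
      ∏ i, MvPolynomial.X (r i), fun y => ?_⟩
  obtain ⟨Q, hQd, hQ⟩ := h y
  have h1 : K y = Q.eval 1 := by simpa using hQ 1
  rw [h1, Polynomial.eval_eq_sum_range' (n := N + 1) (by omega)]
  rw [map_sum]
  refine Finset.sum_congr rfl fun k _ => ?_
  have h2 : iteratedFDeriv ℝ k K 0 (fun _ => y) = k.factorial * Q.coeff k := by
    rw [← Polynomial.iteratedDeriv_eval_ofReal_zero, iteratedDeriv_eq_iteratedFDeriv]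
    have h3 : (fun t : ℝ => Q.eval (t : ℂ)) = K ∘ (ContinuousLinearMap.toSpanSingleton ℝ y) := by
      ext t; simp [hQ]
    rw [h3, ContinuousLinearMap.iteratedFDeriv_comp_right _ hK _ (by exact_mod_cast le_top)]
    simp
  have hy : y = ∑ j, y j • e j := by
    ext i
    fin_cases i <;> simp [he]
  have h4 : iteratedFDeriv ℝ k K 0 (fun _ => y) =
      ∑ r : Fin k → Fin 2, (∏ i, (y (r i) : ℂ)) * iteratedFDeriv ℝ k K 0 fun i => e (r i) := by
    conv_lhs => rw [hy]
    have := (iteratedFDeriv ℝ k K 0).toMultilinearMap.map_sum (α := fun _ => Fin 2)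
      (fun _ j => y j • e j)
    refine this.trans (Finset.sum_congr rfl fun r _ => ?_)
    refine ((iteratedFDeriv ℝ k K 0).toMultilinearMap.map_smul_univ (fun i => y (r i))
      (fun i => e (r i))).trans ?_
    rw [Complex.real_smul, Complex.ofReal_prod]
    rfl
  have hk : (k.factorial : ℂ) ≠ 0 := by exact_mod_cast k.factorial_ne_zero
  have h5 : Q.coeff k = (k.factorial : ℂ)⁻¹ * iteratedFDeriv ℝ k K 0 (fun _ => y) := by
    rw [h2]; field_simp
  rw [h5, h4]
  simp [mul_comm]

end TwoSidedQFT

namespace MvPolynomial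

lemma IsHomogeneous.eval_mul_left {σ R : Type*} [Fintype σ] [CommSemiring R] {φ : MvPolynomial σ R}
    {n : ℕ} (hφ : φ.IsHomogeneous n) (r : R) (z : σ → R) :
    eval (fun j => r * z j) φ = r ^ n * eval z φ := by
  rw [eval_eq', eval_eq', Finset.mul_sum]
  refine Finset.sum_congr rfl fun s hs => ?_
  have h1 : ∑ i, s i = n := by
    rw [hφ.degree_eq_sum_deg_support hs]
    exact (Finset.sum_subset (Finset.subset_univ _) fun i _ hi => by simpa using hi).symm
  simp_rw [mul_pow]
  rw [Finset.prod_mul_distrib, Finset.prod_pow_eq_pow_sum, h1]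
  ring

lemma homogeneousComponent_totalDegree_ne_zero {σ R : Type*} [CommSemiring R] {P : MvPolynomial σ R}
    (hP : P ≠ 0) : homogeneousComponent P.totalDegree P ≠ 0 := by
  obtain ⟨s, hs, hs'⟩ := Finset.exists_mem_eq_sup P.support (support_nonempty.2 hP)
    (fun s => s.sum fun _ e => e)
  intro h
  have h1 := coeff_homogeneousComponent P.totalDegree P s
  rw [h, coeff_zero, if_pos] at h1
  · exact (mem_support_iff.1 hs) h1.symm
  · rw [totalDegree, hs']
    simp [Finsupp.degree, Finsupp.sum]
    rfl

/-- Along rays a polynomial is asymptotic to its leading homogeneous component. -/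
lemma tendsto_eval_mul_div (P : MvPolynomial (Fin 2) ℂ) (z : Fin 2 → ℂ) :
    Tendsto (fun k : ℕ => ((k : ℂ) ^ P.totalDegree)⁻¹ * eval (fun j => (k : ℂ) * z j) P) atTop
      (𝓝 (eval z (homogeneousComponent P.totalDegree P))) := by
  set n := P.totalDegree
  have h1 : ∀ k : ℕ, ((k : ℂ) ^ n)⁻¹ * eval (fun j => (k : ℂ) * z j) P =
      ∑ i ∈ Finset.range (n + 1), (((k : ℂ) ^ n)⁻¹ * (k : ℂ) ^ i) * eval z (homogeneousComponent i P) := by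
    intro k
    conv_lhs => rw [← sum_homogeneousComponent P]
    rw [map_sum, Finset.mul_sum]
    refine Finset.sum_congr rfl fun i _ => ?_
    rw [(homogeneousComponent_isHomogeneous i P).eval_mul_left, mul_assoc]
  simp_rw [h1]
  have h2 : eval z (homogeneousComponent n P) = ∑ i ∈ Finset.range (n + 1),
      (if i = n then 1 else 0) * eval z (homogeneousComponent i P) := by
    simp
  rw [h2]
  refine tendsto_finsetSum _ fun i hi => Tendsto.mul_const _ ?_
  have hin : i ≤ n := Nat.lt_succ_iff.1 (Finset.mem_range.1 hi)
  by_cases h : i = n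
  · rw [if_pos h, h]
    refine tendsto_const_nhds.congr' ?_
    filter_upwards [eventually_ne_atTop 0] with k hk
    have : (k : ℂ) ^ n ≠ 0 := pow_ne_zero _ (by exact_mod_cast hk)
    field_simp
  · rw [if_neg h]
    obtain ⟨m, hm⟩ : ∃ m, n = i + (m + 1) := ⟨n - i - 1, by omega⟩
    have h3 : Tendsto (fun k : ℕ => ((k : ℂ)⁻¹) ^ (m + 1)) atTop (𝓝 0) := by
      have := (tendsto_inv_atTop_nhds_zero_nat (𝕜 := ℂ)).pow (m + 1)
      simpa using this
    refine h3.congr' ?_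
    filter_upwards [eventually_ne_atTop 0] with k hk
    have : (k : ℂ) ≠ 0 := by exact_mod_cast hk
    rw [hm, pow_add (k : ℂ) i (m + 1), mul_inv, inv_pow, mul_right_comm, inv_mul_cancel₀ (pow_ne_zero _ this), one_mul]

end MvPolynomial

namespace TwoSidedQFT

lemma continuous_eval_mul (P : MvPolynomial (Fin 2) ℂ) (ζ : ℂ) :
    Continuous fun y : Plane => P.eval fun j => ζ * (y j : ℂ) := by
  refine (MvPolynomial.continuous_eval P).comp ?_
  fun_prop

/-- If `|P(y)| |P(ζy)| (1 + |y|)^{-d}` is integrable over the plane, where `|ζ| = 1`, then `2 deg P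
+ 2 < d`. Otherwise, the integrals over `|y| > k` being rescaled to `|y| > 1`, Fatou's lemma shows
that the leading homogeneous component of `P` vanishes there. -/
theorem totalDegree_lt_of_lintegral_lt_top {P : MvPolynomial (Fin 2) ℂ} (hP : P ≠ 0) {ζ : ℂ}
    (hζ : ‖ζ‖ = 1) {d : ℝ} (hd : 0 ≤ d)
    (h : ∫⁻ y : Plane, ENNReal.ofReal (‖P.eval fun j => (y j : ℂ)‖ *
      ‖P.eval fun j => ζ * (y j : ℂ)‖ / (1 + ‖y‖) ^ d) < ∞) :
    2 * (P.totalDegree : ℝ) + 2 < d := by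
  by_contra! hcon
  set n := P.totalDegree with hn
  set T := MvPolynomial.homogeneousComponent n P with hT
  have hThom : T.IsHomogeneous n := MvPolynomial.homogeneousComponent_isHomogeneous n P
  set G : Plane → ℝ≥0∞ := fun y => ENNReal.ofReal (‖P.eval fun j => (y j : ℂ)‖ *
      ‖P.eval fun j => ζ * (y j : ℂ)‖ / (1 + ‖y‖) ^ d) with hG
  have hc1 : Continuous fun y : Plane => P.eval fun j => (y j : ℂ) := by
    simpa using continuous_eval_mul P 1
  have hGm : Measurable G := by
    refine Measurable.ennreal_ofReal (Measurable.div ?_ (by fun_prop))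
    exact (hc1.norm.mul (continuous_eval_mul P ζ).norm).measurable
  set S : Set Plane := {u | 1 < ‖u‖} with hS
  have hSo : IsOpen S := isOpen_lt continuous_const continuous_norm
  have hzero : ∫⁻ u in S, liminf (fun k : ℕ => G ((k : ℝ) • u) * ENNReal.ofReal ((k : ℝ) ^ 2)) atTop = 0 := by
    have hfatou := lintegral_liminf_le (u := atTop) (μ := (volume : Measure Plane).restrict S)
      (f := fun (k : ℕ) u => G ((k : ℝ) • u) * ENNReal.ofReal ((k : ℝ) ^ 2))
      (fun k => (hGm.comp (measurable_const_smul _)).mul_const _)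
    have hlim : Tendsto (fun k : ℕ => ∫⁻ u in S, G ((k : ℝ) • u) * ENNReal.ofReal ((k : ℝ) ^ 2))
        atTop (𝓝 0) := by
      have hdom := tendsto_lintegral_of_dominated_convergence (μ := (volume : Measure Plane))
        (F := fun (k : ℕ) x => {x : Plane | (k : ℝ) < ‖x‖}.indicator G x) (f := fun _ => 0) G
        (fun k => hGm.indicator (measurableSet_lt measurable_const measurable_norm))
        (fun k => ae_of_all _ fun x => Set.indicator_le_self _ _ x) h.ne
        (ae_of_all _ fun x => tendsto_const_nhds.congr' (by
          filter_upwards [eventually_ge_atTop ⌈‖x‖⌉₊] with k hk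
          rw [Set.indicator_of_notMem]
          simp only [Set.mem_ofPred_eq, not_lt]
          exact (Nat.le_ceil _).trans (by exact_mod_cast hk)))
      rw [lintegral_zero] at hdom
      refine hdom.congr' ?_
      filter_upwards [eventually_gt_atTop 0] with k hk
      have hk0 : (0 : ℝ) < k := by exact_mod_cast hk
      have hGk : Measurable fun u : Plane => G ((k : ℝ) • u) := hGm.comp (measurable_const_smul _)
      rw [lintegral_mul_const _ hGk, ← lintegral_indicator hSo.measurableSet]
      have hind : ∀ u, S.indicator (fun u => G ((k : ℝ) • u)) u =
          {x : Plane | (k : ℝ) < ‖x‖}.indicator G ((k : ℝ) • u) := by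
        intro u
        have : u ∈ S ↔ (k : ℝ) • u ∈ {x : Plane | (k : ℝ) < ‖x‖} := by
          simp only [hS, Set.mem_ofPred_eq, norm_smul, Real.norm_of_nonneg hk0.le]
          constructor
          · intro h; nlinarith
          · intro h; by_contra h'; nlinarith
        by_cases hu : u ∈ S
        · rw [Set.indicator_of_mem hu, Set.indicator_of_mem (this.1 hu)]
        · rw [Set.indicator_of_notMem hu, Set.indicator_of_notMem (fun h => hu (this.2 h))]
      simp_rw [hind]
      rw [← lintegral_map (μ := (volume : Measure Plane)) (g := fun u : Plane => (k : ℝ) • u)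
        (hGm.indicator (measurableSet_lt measurable_const measurable_norm)) (measurable_const_smul _),
        Measure.map_addHaar_smul _ hk0.ne', lintegral_smul_measure, smul_eq_mul, mul_comm, ← mul_assoc,
        ← ENNReal.ofReal_mul (by positivity)]
      have : (k : ℝ) ^ 2 * |((k : ℝ) ^ Module.finrank ℝ Plane)⁻¹| = 1 := by
        rw [finrank_euclideanSpace_fin, abs_of_nonneg (by positivity)]
        field_simp
      rw [this, ENNReal.ofReal_one, one_mul]
    rw [hlim.liminf_eq] at hfatou
    exact le_antisymm hfatou zero_le
  have hmeas : Measurable fun u => liminf (fun k : ℕ => G ((k : ℝ) • u) * ENNReal.ofReal ((k : ℝ) ^ 2)) atTop :=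
    Measurable.liminf fun k => (hGm.comp (measurable_const_smul _)).mul_const _
  have hae : (fun u : Plane => T.eval fun j => (u j : ℂ)) =ᵐ[volume.restrict S] fun _ => 0 := by
    have h0 := (lintegral_eq_zero_iff hmeas).1 hzero
    filter_upwards [h0, ae_restrict_mem hSo.measurableSet] with u hu huS
    have hu1 : 1 < ‖u‖ := huS
    have hnorm : ∀ ζ : ℂ, Tendsto (fun k : ℕ => ((k : ℝ) ^ n)⁻¹ *
        ‖P.eval fun j => ζ * (((k : ℝ) • u) j : ℂ)‖) atTop
        (𝓝 (‖ζ‖ ^ n * ‖T.eval fun j => (u j : ℂ)‖)) := by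
      intro ζ
      have := (P.tendsto_eval_mul_div fun j => ζ * (u j : ℂ)).norm
      rw [← hn, ← hT, hThom.eval_mul_left, norm_mul, norm_pow] at this
      refine this.congr fun k => ?_
      rw [norm_mul, norm_inv, norm_pow, Complex.norm_natCast]
      congr 4
      ext j
      simp
      ring
    have hlim := ((hnorm 1).mul (hnorm ζ)).div_const ((2 * ‖u‖) ^ d)
    simp only [hζ, norm_one, one_pow, one_mul] at hlim
    have hlim' := ENNReal.tendsto_ofReal hlim
    have hle : ENNReal.ofReal (‖T.eval fun j => (u j : ℂ)‖ * ‖T.eval fun j => (u j : ℂ)‖ / (2 * ‖u‖) ^ d) ≤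
        liminf (fun k : ℕ => G ((k : ℝ) • u) * ENNReal.ofReal ((k : ℝ) ^ 2)) atTop := by
      rw [← hlim'.liminf_eq]
      refine liminf_le_liminf ?_
      filter_upwards [eventually_ge_atTop 1] with k hk
      have hk1 : (1 : ℝ) ≤ k := by exact_mod_cast hk
      rw [hG]
      simp only
      rw [← ENNReal.ofReal_mul (by positivity)]
      refine ENNReal.ofReal_le_ofReal ?_
      rw [norm_smul, Real.norm_of_nonneg (by linarith : (0 : ℝ) ≤ k)]
      set a := ‖P.eval fun j => (((k : ℝ) • u) j : ℂ)‖
      set b := ‖P.eval fun j => ζ * (((k : ℝ) • u) j : ℂ)‖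
      have hden : (1 + (k : ℝ) * ‖u‖) ^ d ≤ (2 * ‖u‖) ^ d * ((k : ℝ) ^ n * (k : ℝ) ^ n * (k : ℝ) ^ 2) := by
        calc (1 + (k : ℝ) * ‖u‖) ^ d ≤ ((2 * ‖u‖) * k) ^ d := by
              gcongr
              nlinarith
          _ = (2 * ‖u‖) ^ d * (k : ℝ) ^ d := Real.mul_rpow (by positivity) (by positivity)
          _ ≤ (2 * ‖u‖) ^ d * (k : ℝ) ^ (2 * (n : ℝ) + 2) := by
              gcongr
          _ = _ := by
              rw [show 2 * (n : ℝ) + 2 = ((n + n + 2 : ℕ) : ℝ) by push_cast; ring, Real.rpow_natCast,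
                pow_add, pow_add]
      rw [div_mul_eq_mul_div, div_le_div_iff₀ (by positivity) (by positivity)]
      calc _ = a * b * ((k : ℝ) ^ n * (k : ℝ) ^ n)⁻¹ * (1 + (k : ℝ) * ‖u‖) ^ d := by
            rw [mul_inv]; ring
        _ ≤ a * b * ((k : ℝ) ^ n * (k : ℝ) ^ n)⁻¹ *
            ((2 * ‖u‖) ^ d * ((k : ℝ) ^ n * (k : ℝ) ^ n * (k : ℝ) ^ 2)) := by gcongr
        _ = _ := by field_simp
    have h1 : ENNReal.ofReal (‖T.eval fun j => (u j : ℂ)‖ * ‖T.eval fun j => (u j : ℂ)‖ / (2 * ‖u‖) ^ d) ≤ 0 :=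
      hle.trans (le_of_eq hu)
    rw [nonpos_iff_eq_zero, ENNReal.ofReal_eq_zero] at h1
    have h2 : 0 < (2 * ‖u‖) ^ d := by positivity
    have h3 : ‖T.eval fun j => (u j : ℂ)‖ * ‖T.eval fun j => (u j : ℂ)‖ ≤ 0 := by
      rwa [div_le_iff₀ h2, zero_mul] at h1
    have h4 : ‖T.eval fun j => (u j : ℂ)‖ = 0 := by nlinarith [norm_nonneg (T.eval fun j => (u j : ℂ))]
    exact norm_eq_zero.1 h4
  have hTc : Continuous fun y : Plane => T.eval fun j => (y j : ℂ) := by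
    simpa using continuous_eval_mul T 1
  -- a polynomial that vanishes on `|y| > 1` is zero
  have heq := Measure.eqOn_open_of_ae_eq hae hSo hTc.continuousOn continuousOn_const
  refine MvPolynomial.homogeneousComponent_totalDegree_ne_zero hP (hT.symm.trans ?_)
  have hinf : ((fun r : ℝ => (r : ℂ)) '' Set.Ioi 1).Infinite :=
    (Set.infinite_image_iff Complex.ofReal_injective.injOn).2 (Set.Ioi_infinite 1)
  refine MvPolynomial.funext_set (fun _ => (fun r : ℝ => (r : ℂ)) '' Set.Ioi 1) (fun _ => hinf) ?_
  intro x hx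
  choose r hr hrx using fun j => hx j (Set.mem_univ j)
  have hx' : x = fun j => ((WithLp.toLp 2 r : Plane) j : ℂ) := by
    ext j; simp [← hrx j]
  rw [hx', map_zero]
  refine heq ?_
  have h1 : 1 < r 0 := hr 0
  have h2 := PiLp.norm_apply_le (WithLp.toLp 2 r : Plane) 0
  simp only [hS, Set.mem_ofPred_eq]
  refine lt_of_lt_of_le h1 ((le_abs_self _).trans ?_)
  simpa using h2

end TwoSidedQFT

/-! ### Polynomials times Gaussians -/

lemma integrable_pow_mul_cexp_neg_mul_sq {b : ℝ} (hb : 0 < b) (k : ℕ) :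
    Integrable fun t : ℝ => (t : ℂ) ^ k * Complex.exp (-(b * (t : ℂ) ^ 2)) := by
  have h := (integrable_rpow_mul_exp_neg_mul_sq hb (s := k)
    (by have : (0 : ℝ) ≤ k := k.cast_nonneg
        linarith))
  refine (Complex.ofRealCLM.integrable_comp h).congr (ae_of_all _ fun t => ?_)
  simp only [Real.rpow_natCast, Complex.ofRealCLM_apply]
  push_cast
  ring_nf

open Polynomial in
/-- The one-dimensional Fourier transform of a monomial times a Gaussian is a polynomial of at most
the same degree times the dual Gaussian. -/
lemma exists_fourier_pow_mul_gaussian {b : ℝ} (hb : 0 < b) (k : ℕ) :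
    ∃ q : ℂ[X], q.natDegree ≤ k ∧ ∀ x : ℝ,
      𝓕 (fun t : ℝ => (t : ℂ) ^ k * Complex.exp (-(b * (t : ℂ) ^ 2))) x =
        q.eval (x : ℂ) * Complex.exp (-(Real.pi ^ 2 / b * (x : ℂ) ^ 2)) := by
  have hbC : (b : ℂ) ≠ 0 := by exact_mod_cast hb.ne'
  induction k with
  | zero =>
    refine ⟨C ((Real.pi / b : ℂ) ^ (1 / 2 : ℂ)), by simp, fun x => ?_⟩
    have := fourier_gaussian_innerProductSpace (V := ℝ) (b := (b : ℂ)) (by simpa using hb) x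
    simp only [Module.finrank_self, Nat.cast_one, Real.norm_eq_abs, ← Complex.ofReal_pow, sq_abs] at this
    simp only [pow_zero, one_mul, eval_C]
    simp only [Complex.ofReal_pow, neg_mul] at this
    rw [this]
    congr 2
    ring
  | succ k ih =>
    obtain ⟨q, hq, hqe⟩ := ih
    refine ⟨C (Complex.I / (2 * Real.pi)) * (derivative q - C (2 * (Real.pi ^ 2 / b) : ℂ) * (X * q)), ?_,
      fun x => ?_⟩
    · refine (natDegree_C_mul_le _ _).trans ((natDegree_sub_le _ _).trans (max_le ?_ ?_))
      · exact (natDegree_derivative_le q).trans (by omega)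
      · refine (natDegree_C_mul_le _ _).trans (natDegree_mul_le.trans ?_)
        have := natDegree_X_le (R := ℂ)
        omega
    have hint := integrable_pow_mul_cexp_neg_mul_sq hb k
    have hint' := integrable_pow_mul_cexp_neg_mul_sq hb (k + 1)
    have hd := Real.deriv_fourier hint (hint'.congr (ae_of_all _ fun t => by
      simp [pow_succ]; ring))
    have hfun : 𝓕 (fun t : ℝ => (t : ℂ) ^ k * Complex.exp (-(b * (t : ℂ) ^ 2))) =
        fun x : ℝ => q.eval (x : ℂ) * Complex.exp (-(Real.pi ^ 2 / b * (x : ℂ) ^ 2)) := funext hqe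
    have hder : HasDerivAt (fun x : ℝ => q.eval (x : ℂ) * Complex.exp (-(Real.pi ^ 2 / b * (x : ℂ) ^ 2)))
        ((derivative q - C (2 * (Real.pi ^ 2 / b) : ℂ) * (X * q)).eval (x : ℂ) *
          Complex.exp (-(Real.pi ^ 2 / b * (x : ℂ) ^ 2))) x := by
      have h1 : HasDerivAt (fun z : ℂ => -(Real.pi ^ 2 / b * z ^ 2)) (-(Real.pi ^ 2 / b * (2 * x))) (x : ℂ) := by
        have := ((hasDerivAt_pow 2 (x : ℂ)).const_mul (Real.pi ^ 2 / b : ℂ)).fun_neg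
        simpa using this
      have h2 := ((q.hasDerivAt (x : ℂ)).mul h1.cexp).comp_ofReal
      refine h2.congr_deriv ?_
      simp
      ring
    have h3 := congrFun hd x
    rw [hfun, hder.deriv] at h3
    have h4 : (fun t : ℝ => (-2 * Real.pi * Complex.I * t) • ((t : ℂ) ^ k *
        Complex.exp (-(b * (t : ℂ) ^ 2)))) = fun t : ℝ => (-2 * Real.pi * Complex.I) •
          ((t : ℂ) ^ (k + 1) * Complex.exp (-(b * (t : ℂ) ^ 2))) := by
      ext t; simp only [smul_eq_mul]; ring
    rw [h4] at h3
    have h5 : 𝓕 (fun t : ℝ => (-2 * Real.pi * Complex.I : ℂ) •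
          ((t : ℂ) ^ (k + 1) * Complex.exp (-(b * (t : ℂ) ^ 2)))) x = (-2 * Real.pi * Complex.I) *
        𝓕 (fun t : ℝ => (t : ℂ) ^ (k + 1) * Complex.exp (-(b * (t : ℂ) ^ 2))) x := by
      rw [Real.fourier_eq, Real.fourier_eq, ← integral_const_mul]
      refine integral_congr_ae (ae_of_all _ fun t => ?_)
      simp only [Circle.smul_def, smul_eq_mul]
      ring
    rw [h5] at h3
    rw [eval_mul, mul_assoc, h3, eval_C]
    have hpi : (Real.pi : ℂ) ≠ 0 := by exact_mod_cast Real.pi_ne_zero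
    field_simp
    linear_combination (𝓕 (fun t : ℝ => (t : ℂ) ^ (k + 1) * Complex.exp (-(b * (t : ℂ) ^ 2))) x) * Complex.I_mul_I

namespace TwoSidedQFT

/-- The product of a complex polynomial and the Gaussian `e^{-b|x|²}`. -/
def polyGauss (P : MvPolynomial (Fin 2) ℂ) (b : ℝ) (x : Plane) : ℂ :=
  P.eval (fun j => (x j : ℂ)) * Real.exp (-(b * ‖x‖ ^ 2))

lemma polyGauss_monomial (s : Fin 2 →₀ ℕ) (c : ℂ) (b : ℝ) (x : Plane) :
    polyGauss (MvPolynomial.monomial s c) b x =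
      c * ∏ j, ((x j : ℂ) ^ s j * Complex.exp (-(b * (x j : ℂ) ^ 2))) := by
  have h1 : ‖x‖ ^ 2 = x 0 ^ 2 + x 1 ^ 2 := by
    rw [EuclideanSpace.real_norm_sq_eq, Fin.sum_univ_two]
  rw [polyGauss, MvPolynomial.eval_monomial, Finsupp.prod_fintype _ _ (by simp), h1,
    Fin.prod_univ_two, Fin.prod_univ_two]
  have h2 : ((Real.exp (-(b * (x 0 ^ 2 + x 1 ^ 2))) : ℝ) : ℂ) =
      Complex.exp (-(b * (x 0 : ℂ) ^ 2)) * Complex.exp (-(b * (x 1 : ℂ) ^ 2)) := by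
    rw [← Complex.exp_add]
    push_cast
    congr 1
    ring
  rw [h2]
  ring

lemma continuous_polyGauss (P : MvPolynomial (Fin 2) ℂ) (b : ℝ) : Continuous (polyGauss P b) := by
  have := continuous_eval_mul P 1
  simp only [one_mul] at this
  unfold polyGauss
  fun_prop

lemma polyGauss_add (P Q : MvPolynomial (Fin 2) ℂ) (b : ℝ) :
    polyGauss (P + Q) b = polyGauss P b + polyGauss Q b := by
  ext x; simp [polyGauss, add_mul]

lemma integrable_polyGauss (P : MvPolynomial (Fin 2) ℂ) {b : ℝ} (hb : 0 < b) :
    Integrable (polyGauss P b) := by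
  induction P using MvPolynomial.induction_on' with
  | monomial s c =>
    have h : Integrable (fun x : Fin 2 → ℝ => ∏ j, ((x j : ℂ) ^ s j *
        Complex.exp (-(b * (x j : ℂ) ^ 2)))) :=
      Integrable.fintype_prod (f := fun j (t : ℝ) => (t : ℂ) ^ s j * Complex.exp (-(b * (t : ℂ) ^ 2)))
        fun j => integrable_pow_mul_cexp_neg_mul_sq hb (s j)
    have h' := ((PiLp.volume_preserving_ofLp (Fin 2)).integrable_comp h.aestronglyMeasurable).2 h
    refine (h'.const_mul c).congr (ae_of_all _ fun x => ?_)
    rw [polyGauss_monomial]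
    rfl
  | add P Q hP hQ =>
    rw [polyGauss_add]
    exact hP.add hQ

/-- The Fourier transform of a polynomial times a Gaussian is a polynomial of at most the same
degree times the dual Gaussian. -/
theorem exists_fourier_polyGauss (P : MvPolynomial (Fin 2) ℂ) {b : ℝ} (hb : 0 < b) :
    ∃ Q : MvPolynomial (Fin 2) ℂ, Q.totalDegree ≤ P.totalDegree ∧
      𝓕 (polyGauss P b) = polyGauss Q (Real.pi ^ 2 / b) := by
  -- the case of a monomial, by Fubini's theorem
  have hmon : ∀ (s : Fin 2 →₀ ℕ) (c : ℂ), ∃ Q : MvPolynomial (Fin 2) ℂ, Q.totalDegree ≤ s.degree ∧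
      𝓕 (polyGauss (MvPolynomial.monomial s c) b) = polyGauss Q (Real.pi ^ 2 / b) := by
    intro s c
    choose q hq hqe using fun k => exists_fourier_pow_mul_gaussian hb k
    refine ⟨MvPolynomial.C c * ∏ j, Polynomial.aeval (MvPolynomial.X j) (q (s j)), ?_, ?_⟩
    · have hX : ∀ j : Fin 2, (Polynomial.aeval (MvPolynomial.X j : MvPolynomial (Fin 2) ℂ)
          (q (s j))).totalDegree ≤ s j := by
        intro j
        rw [Polynomial.aeval_eq_sum_range]
        refine MvPolynomial.totalDegree_finsetSum_le fun i hi => ?_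
        refine (MvPolynomial.totalDegree_smul_le _ _).trans ?_
        rw [MvPolynomial.totalDegree_X_pow]
        have := Finset.mem_range.1 hi
        have := hq (s j)
        omega
      refine (MvPolynomial.totalDegree_mul _ _).trans ?_
      rw [MvPolynomial.totalDegree_C, zero_add]
      refine (MvPolynomial.totalDegree_finsetProd _ _).trans ?_
      rw [Finsupp.degree_eq_sum]
      exact Finset.sum_le_sum fun j _ => hX j
    · ext w
      set g : Fin 2 → ℝ → ℂ := fun j t => Complex.exp (((-2 * Real.pi * (t * w j) : ℝ) : ℂ) * Complex.I) *
        ((t : ℂ) ^ s j * Complex.exp (-(b * (t : ℂ) ^ 2))) with hg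
      have h1 : ∀ x : Plane, Complex.exp (((-2 * Real.pi * inner ℝ x w : ℝ) : ℂ) * Complex.I) •
          polyGauss (MvPolynomial.monomial s c) b x = c * ∏ j, g j (x j) := by
        intro x
        have hin : inner ℝ x w = x 0 * w 0 + x 1 * w 1 := by
          simp [PiLp.inner_apply, Fin.sum_univ_two, mul_comm]
        rw [polyGauss_monomial, hin, hg]
        simp only [Fin.prod_univ_two, smul_eq_mul]
        rw [mul_add, Complex.ofReal_add, add_mul, Complex.exp_add]
        ring
      have h2 : ∀ j, ∫ t, g j t = (q (s j)).eval (w j : ℂ) *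
          Complex.exp (-(Real.pi ^ 2 / b * (w j : ℂ) ^ 2)) := by
        intro j
        rw [← hqe (s j) (w j), Real.fourier_eq']
        refine integral_congr_ae (ae_of_all _ fun t => ?_)
        simp only [hg, smul_eq_mul]
        congr 4
        simp [mul_comm]
      have h3 : ∫ a : Plane, ∏ j, g j (a j) = ∫ x : Fin 2 → ℝ, ∏ j, g j (x j) :=
        (EuclideanSpace.volume_preserving_symm_measurableEquiv_toLp (Fin 2)).integral_comp'
          (fun x : Fin 2 → ℝ => ∏ j, g j (x j))
      rw [Real.fourier_eq', integral_congr_ae (ae_of_all _ h1), integral_const_mul, h3,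
        integral_fintype_prod_volume_eq_prod]
      simp_rw [h2]
      have hn : ‖w‖ ^ 2 = w 0 ^ 2 + w 1 ^ 2 := by
        rw [EuclideanSpace.real_norm_sq_eq, Fin.sum_univ_two]
      have hexp : ((Real.exp (-(Real.pi ^ 2 / b * ‖w‖ ^ 2)) : ℝ) : ℂ) =
          Complex.exp (-(Real.pi ^ 2 / b * (w 0 : ℂ) ^ 2)) *
            Complex.exp (-(Real.pi ^ 2 / b * (w 1 : ℂ) ^ 2)) := by
        rw [hn, ← Complex.exp_add]
        push_cast
        congr 1
        ring
      have hev : ∀ j, MvPolynomial.eval (fun j => (w j : ℂ))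
          (Polynomial.aeval (MvPolynomial.X j) (q (s j))) = (q (s j)).eval (w j : ℂ) := by
        intro j
        rw [Polynomial.aeval_def, Polynomial.hom_eval₂]
        simp only [MvPolynomial.algebraMap_eq, MvPolynomial.eval_X]
        have : (MvPolynomial.eval fun j => (w j : ℂ)).comp MvPolynomial.C = RingHom.id ℂ := by
          ext; simp
        rw [this, Polynomial.eval₂_id]
      rw [polyGauss, hexp, map_mul, map_prod, MvPolynomial.eval_C]
      simp only [Fin.prod_univ_two, hev]
      ring
  choose Q hQd hQ using hmon
  refine ⟨∑ s ∈ P.support, Q s (P.coeff s), ?_, ?_⟩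
  · refine MvPolynomial.totalDegree_finsetSum_le fun s hs => (hQd _ _).trans ?_
    exact MvPolynomial.le_totalDegree hs
  · ext w
    have hP : ∀ x, polyGauss P b x =
        ∑ s ∈ P.support, polyGauss (MvPolynomial.monomial s (P.coeff s)) b x := by
      intro x
      conv_lhs => rw [P.as_sum]
      simp only [polyGauss, map_sum, Finset.sum_mul]
    have hQ' : polyGauss (∑ s ∈ P.support, Q s (P.coeff s)) (Real.pi ^ 2 / b) w =
        ∑ s ∈ P.support, 𝓕 (polyGauss (MvPolynomial.monomial s (P.coeff s)) b) w := by
      simp only [hQ]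
      simp only [polyGauss, map_sum, Finset.sum_mul]
    rw [hQ', Real.fourier_eq]
    simp_rw [hP, Finset.smul_sum]
    rw [integral_finsetSum]
    · rfl
    · intro s _
      exact (Real.fourierIntegral_convergent_iff w).2 (integrable_polyGauss _ hb)

/-! ### Restriction to complexified lines -/

section

variable {f : Plane → ℂ} {u : Plane → ℝ}

lemma gaussFourier_smul (ζ : ℂ) (r : ℝ) (y : Plane) :
    gaussFourier f ζ (r • y) = gaussFourier f (ζ * r) y := by
  simp only [gaussFourier, inner_smul_right]
  refine integral_congr_ae (ae_of_all _ fun x => ?_)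
  dsimp only
  congr 2
  push_cast
  ring

lemma exists_eq_norm_smul (y : Plane) : ∃ ω : Plane, ‖ω‖ = 1 ∧ y = ‖y‖ • ω := by
  by_cases hy : y = 0
  · exact ⟨EuclideanSpace.single 0 1, by simp, by simp [hy]⟩
  · exact ⟨‖y‖⁻¹ • y, norm_smul_inv_norm hy, by rw [smul_inv_smul₀ (norm_ne_zero_iff.2 hy)]⟩

/-- On a complexified line through the origin the Fourier transform is a polynomial times a
Gaussian. -/
lemma exists_gaussFourier_eq_polynomial_mul_exp (hf : AEStronglyMeasurable f) (hu : MemLp u 2)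
    (hu0 : ∀ x, 0 ≤ u x) (hfu : ∀ x, ‖f x‖ ≤ u x) {C : ℝ} {N : ℕ}
    (hC : ∀ y, ‖gaussFourier f 1 y‖ * gaussMajorant u ‖y‖ ≤ C * (1 + ‖y‖) ^ N) {ω : Plane}
    (hω : ‖ω‖ = 1) :
    ∃ (Q : Polynomial ℂ) (b : ℂ), Q.natDegree ≤ N ∧
      ∀ z, gaussFourier f z ω = Q.eval z * Complex.exp (-(b * z ^ 2)) := by
  by_cases h0 : ∀ z, gaussFourier f z ω = 0
  · exact ⟨0, 0, by simp, by simpa using h0⟩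
  push Not at h0
  obtain ⟨z₀, hz₀⟩ := h0
  have hd := differentiable_gaussFourier hf hu hfu ω
  set A := ∫ x : Plane, u x * Real.exp (-(Real.pi / 2 * ‖x‖ ^ 2)) with hA
  have hA0 : 0 ≤ A := integral_nonneg fun x => mul_nonneg (hu0 x) (Real.exp_nonneg _)
  have hbound : ∀ z, ‖gaussFourier f z ω‖ ≤ gaussMajorant u |z.im| := fun z => by
    simpa [hω] using norm_gaussFourier_le hu hfu z ω
  obtain ⟨G, hGN, hG⟩ := exists_polynomial_mul_rotate hd (M := gaussMajorant u)
    (B := 2 * Real.pi) (N := N) (C := C) (by positivity)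
    (fun r _ s _ hrs => gaussMajorant_mono hu hu0 hrs)
    (fun r _ => gaussMajorant_le hu hu0 r) hbound (fun r => by
      have := hC (r • ω)
      rw [gaussFourier_smul, one_mul] at this
      simpa [norm_smul, hω] using this)
  -- a product of two nonzero entire functions is nonzero
  have hG0 : G ≠ 0 := by
    rintro rfl
    have hprod : ∀ z, gaussFourier f z ω * gaussFourier f (Complex.I * z) ω = 0 := by simpa using hG
    have hI : Differentiable ℂ fun z => gaussFourier f (Complex.I * z) ω :=
      hd.comp (differentiable_id.const_mul Complex.I)
    rcases (AnalyticOnNhd.eq_zero_or_eq_zero_of_mul_eq_zero (U := Set.univ)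
      (hd.differentiableOn.analyticOnNhd isOpen_univ)
      (hI.differentiableOn.analyticOnNhd isOpen_univ) (fun z _ => hprod z)
      isPreconnected_univ) with h | h
    · exact hz₀ (h _ (Set.mem_univ _))
    · have := h (-Complex.I * z₀) (Set.mem_univ _)
      rw [← mul_assoc] at this
      simp at this
      exact hz₀ this
  obtain ⟨Q, b, hQ, hQe⟩ := exists_eq_polynomial_mul_exp hd (B := 2 * Real.pi) (A := A)
    (by positivity) (fun z => by
      refine (hbound z).trans ((gaussMajorant_le hu hu0 _).trans ?_)
      refine mul_le_mul_of_nonneg_left ?_ hA0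
      rw [Real.exp_le_exp]
      have := Complex.abs_im_le_norm z
      gcongr) hG0 hG
  exact ⟨Q, b, hQ.trans hGN, hQe⟩

/-- All moments of `e^{-π|x|²} f(x)` are finite. -/
lemma integrable_norm_pow_mul_gaussian_mul (hf : AEStronglyMeasurable f) (hu : MemLp u 2)
    (hfu : ∀ x, ‖f x‖ ≤ u x) (n : ℕ) :
    Integrable fun x : Plane => ‖x‖ ^ n * ‖(Real.exp (-(Real.pi * ‖x‖ ^ 2)) : ℂ) * f x‖ := by
  refine ((integrable_mul_exp_majorant hu 1).const_mul (n.factorial : ℝ)).mono' ?_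
    (ae_of_all _ fun x => ?_)
  · have : Continuous fun x : Plane => (Real.exp (-(Real.pi * ‖x‖ ^ 2)) : ℂ) := by fun_prop
    exact (by fun_prop : Continuous fun x : Plane => ‖x‖ ^ n).aestronglyMeasurable.mul
      (this.aestronglyMeasurable.mul hf).norm
  · have hu0 : 0 ≤ u x := (norm_nonneg _).trans (hfu x)
    rw [Real.norm_of_nonneg (by positivity), norm_mul, Complex.norm_real,
      Real.norm_of_nonneg (Real.exp_nonneg _), Real.exp_add]
    have h1 : ‖x‖ ^ n ≤ n.factorial * Real.exp (2 * Real.pi * 1 * ‖x‖) := by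
      have h2 := Real.pow_div_factorial_le_exp ‖x‖ (norm_nonneg x) n
      rw [div_le_iff₀ (by positivity), mul_comm] at h2
      refine h2.trans ?_
      gcongr
      nlinarith [Real.pi_gt_three, norm_nonneg x]
    calc ‖x‖ ^ n * (Real.exp (-(Real.pi * ‖x‖ ^ 2)) * ‖f x‖)
        ≤ (n.factorial * Real.exp (2 * Real.pi * 1 * ‖x‖)) *
          (Real.exp (-(Real.pi * ‖x‖ ^ 2)) * u x) := by
          gcongr
          exact hfu x
      _ = _ := by ring

lemma contDiff_gaussFourier_one (hf : AEStronglyMeasurable f) (hu : MemLp u 2)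
    (hfu : ∀ x, ‖f x‖ ≤ u x) : ContDiff ℝ (⊤ : ℕ∞) (gaussFourier f 1) := by
  have h : gaussFourier f 1 =
      𝓕 (fun x : Plane => (Real.exp (-(Real.pi * ‖x‖ ^ 2)) : ℂ) * f x) := by
    ext y
    simpa using gaussFourier_ofReal (f := f) 1 y
  rw [h]
  exact Real.contDiff_fourier fun n _ => integrable_norm_pow_mul_gaussian_mul hf hu hfu n

/-- The Riemann–Lebesgue lemma along a line. -/
lemma tendsto_gaussFourier_atTop {ω : Plane} (hω : ‖ω‖ = 1) :
    Tendsto (fun r : ℝ => gaussFourier f r ω) atTop (𝓝 0) := by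
  have h1 := tendsto_integral_exp_inner_smul_cocompact
    (fun x : Plane => (Real.exp (-(Real.pi * ‖x‖ ^ 2)) : ℂ) * f x)
  have h2 : Tendsto (fun r : ℝ => r • ω) atTop (cocompact Plane) := by
    rw [← Metric.cobounded_eq_cocompact, ← tendsto_norm_atTop_iff_cobounded]
    simp only [norm_smul, hω, mul_one, Real.norm_eq_abs]
    exact tendsto_abs_atTop_atTop
  refine (h1.comp h2).congr fun r => ?_
  rw [gaussFourier_ofReal, Real.fourier_eq]
  rfl

/-- If the Fourier transform of `e^{-π|x|²} f(x)` is a polynomial of bounded degree times a fixed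
Gaussian on each complexified line through the origin, it is a polynomial times a Gaussian. -/
lemma exists_gaussFourier_eq_mvPolynomial_mul_exp (hf : AEStronglyMeasurable f) (hu : MemLp u 2)
    (hfu : ∀ x, ‖f x‖ ≤ u x) {N : ℕ} {β : ℝ}
    (h : ∀ ω : Plane, ‖ω‖ = 1 → ∃ Q : Polynomial ℂ, Q.natDegree ≤ N ∧
      ∀ z, gaussFourier f z ω = Q.eval z * Complex.exp (-(β * z ^ 2))) :
    ∃ K : MvPolynomial (Fin 2) ℂ, ∀ (ζ : ℂ) (y : Plane),
      gaussFourier f ζ y = K.eval (fun j => ζ * (y j : ℂ)) *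
        Complex.exp (-(β * ζ ^ 2 * (‖y‖ ^ 2 : ℝ))) := by
  set E : Plane → ℂ := fun y => gaussFourier f 1 y * Complex.exp ((β * ‖y‖ ^ 2 : ℝ)) with hE
  have hsm : ContDiff ℝ (⊤ : ℕ∞) E := by
    refine (contDiff_gaussFourier_one hf hu hfu).mul ?_
    have h1 : ContDiff ℝ (⊤ : ℕ∞) fun y : Plane => Real.exp (β * ‖y‖ ^ 2) :=
      (contDiff_const.mul (contDiff_norm_sq ℝ)).exp
    have h2 := Complex.ofRealCLM.contDiff.comp h1
    have h3 : (fun y : Plane => Complex.exp ((β * ‖y‖ ^ 2 : ℝ))) =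
        Complex.ofRealCLM ∘ fun y : Plane => Real.exp (β * ‖y‖ ^ 2) := by
      ext y
      simp
    rw [h3]
    exact h2
  have hline : ∀ ω : Plane, ‖ω‖ = 1 → ∀ Q : Polynomial ℂ,
      (∀ z, gaussFourier f z ω = Q.eval z * Complex.exp (-(β * z ^ 2))) →
      ∀ t : ℝ, E (t • ω) = Q.eval (t : ℂ) := by
    intro ω hω Q hQ t
    rw [hE]
    dsimp only
    rw [gaussFourier_smul, one_mul, hQ, mul_assoc, ← Complex.exp_add]
    have : (-(β * (t : ℂ) ^ 2) + ((β * ‖t • ω‖ ^ 2 : ℝ) : ℂ)) = 0 := by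
      rw [norm_smul, hω, mul_one, Real.norm_eq_abs, sq_abs]
      push_cast
      ring
    rw [this, Complex.exp_zero, mul_one]
  obtain ⟨K, hK⟩ := exists_mvPolynomial_of_lines hsm N (by
    intro y
    obtain ⟨ω, hω, hy⟩ := exists_eq_norm_smul y
    obtain ⟨Q, hQd, hQ⟩ := h ω hω
    refine ⟨Q.comp (Polynomial.C (‖y‖ : ℂ) * Polynomial.X), ?_, fun t => ?_⟩
    · refine Polynomial.natDegree_comp_le.trans ?_
      calc _ ≤ N * 1 := Nat.mul_le_mul hQd ((Polynomial.natDegree_C_mul_le _ _).trans Polynomial.natDegree_X_le)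
        _ = N := mul_one N
    · conv_lhs => rw [hy, smul_smul]
      rw [hline ω hω Q hQ, Polynomial.eval_comp, Polynomial.eval_mul, Polynomial.eval_C,
        Polynomial.eval_X, Complex.ofReal_mul, mul_comm (t : ℂ)])
  refine ⟨K, fun ζ y => ?_⟩
  obtain ⟨ω, hω, hy⟩ := exists_eq_norm_smul y
  obtain ⟨Q, hQd, hQ⟩ := h ω hω
  -- the restriction of `K` to the complexified line through `ω`
  set R : Polynomial ℂ := MvPolynomial.aeval (fun j => Polynomial.C (ω j : ℂ) * Polynomial.X) K with hR
  have hRe : ∀ z, R.eval z = K.eval fun j => z * (ω j : ℂ) := by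
    intro z
    rw [hR, MvPolynomial.aeval_def, ← Polynomial.coe_evalRingHom, MvPolynomial.hom_eval₂]
    have h1 : (Polynomial.evalRingHom z).comp (algebraMap ℂ (Polynomial ℂ)) = RingHom.id ℂ := by
      ext c; simp
    have h2 : (fun j => Polynomial.evalRingHom z (Polynomial.C (ω j : ℂ) * Polynomial.X)) =
        fun j => z * (ω j : ℂ) := by
      ext j
      rw [Polynomial.coe_evalRingHom, Polynomial.eval_mul, Polynomial.eval_C, Polynomial.eval_X,
        mul_comm]
    rw [h1, h2, MvPolynomial.eval₂_id]
  have hRQ : R = Q := by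
    refine Polynomial.eq_of_infinite_eval_eq _ _
      ((Set.infinite_range_of_injective Complex.ofReal_injective).mono ?_)
    rintro _ ⟨t, rfl⟩
    change R.eval (t : ℂ) = Q.eval (t : ℂ)
    rw [← hline ω hω Q hQ t, hK, hRe]
    simp
  have hyj : ∀ j, (y j : ℂ) = ‖y‖ * ω j := fun j => by
    conv_lhs => rw [hy]
    simp
  conv_lhs => rw [hy, gaussFourier_smul, hQ, ← hRQ, hRe]
  simp only [hyj, mul_assoc]
  congr 3
  push_cast
  ring

/-! ### Fourier inversion -/

lemma memLp_gaussian_mul (hf : MemLp f 2) :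
    MemLp (fun x : Plane => (Real.exp (-(Real.pi * ‖x‖ ^ 2)) : ℂ) * f x) 2 := by
  have : Continuous fun x : Plane => (Real.exp (-(Real.pi * ‖x‖ ^ 2)) : ℂ) := by fun_prop
  refine hf.of_le (this.aestronglyMeasurable.mul hf.1) (ae_of_all _ fun x => ?_)
  rw [norm_mul, Complex.norm_real, Real.norm_of_nonneg (Real.exp_nonneg _)]
  exact mul_le_of_le_one_left (norm_nonneg _) (Real.exp_le_one_iff.2 (by
    have := Real.pi_pos; nlinarith [sq_nonneg ‖x‖]))

lemma integrable_gaussian_mul (hf : MemLp f 2) :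
    Integrable fun x : Plane => (Real.exp (-(Real.pi * ‖x‖ ^ 2)) : ℂ) * f x := by
  have : Continuous fun x : Plane => (Real.exp (-(Real.pi * ‖x‖ ^ 2)) : ℂ) := by fun_prop
  refine (integrable_norm_iff (this.aestronglyMeasurable.mul hf.1)).1 ?_
  simpa using integrable_norm_pow_mul_gaussian_mul hf.1 hf.norm (fun x => le_rfl) 0

/-- A function in `L¹ ∩ L²` is determined by its Fourier transform. -/
lemma ae_eq_of_fourier_eq {g h : Plane → ℂ} (hg1 : Integrable g) (hg2 : MemLp g 2)
    (hh1 : Integrable h) (hh2 : MemLp h 2) (hgh : 𝓕 g = 𝓕 h) : g =ᵐ[volume] h := by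
  have h1 : (𝓕 (hg2.toLp g) : Lp ℂ 2 (volume : Measure Plane)) = 𝓕 (hh2.toLp h) := by
    apply Lp.ext
    refine (fourier_toLp_ae_eq hg1 hg2).trans ?_
    rw [hgh]
    exact (fourier_toLp_ae_eq hh1 hh2).symm
  have h2 : hg2.toLp g = hh2.toLp h := by
    have := (Lp.fourierTransformₗᵢ Plane ℂ).injective (a₁ := hg2.toLp g) (a₂ := hh2.toLp h) h1
    exact this
  exact hg2.coeFn_toLp.symm.trans (h2 ▸ hh2.coeFn_toLp)

lemma memLp_polyGauss (P : MvPolynomial (Fin 2) ℂ) {b : ℝ} (hb : 0 < b) :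
    MemLp (polyGauss P b) 2 := by
  rw [memLp_two_iff_integrable_sq_norm (continuous_polyGauss P b).aestronglyMeasurable]
  have h := (integrable_polyGauss (P * P) (b := 2 * b) (by positivity)).norm
  refine h.congr (ae_of_all _ fun x => ?_)
  simp only [polyGauss, map_mul, norm_mul, Complex.norm_real, Real.norm_of_nonneg (Real.exp_nonneg _),
    mul_pow, ← Real.exp_nat_mul]
  rw [← sq]
  congr 2
  push_cast
  ring

/-- Fourier inversion for a polynomial times a Gaussian. -/
lemma exists_polyGauss_fourier_eq (K : MvPolynomial (Fin 2) ℂ) {b : ℝ} (hb : 0 < b) :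
    ∃ P : MvPolynomial (Fin 2) ℂ, P.totalDegree ≤ K.totalDegree ∧
      𝓕 (polyGauss P (Real.pi ^ 2 / b)) = polyGauss K b := by
  obtain ⟨P₁, hd₁, h₁⟩ := exists_fourier_polyGauss K hb
  have hb' : 0 < Real.pi ^ 2 / b := by positivity
  obtain ⟨P, hd, h⟩ := exists_fourier_polyGauss P₁ hb'
  -- applying the transform three times inverts it
  obtain ⟨P₂, hd₂, h₂⟩ := exists_fourier_polyGauss P (b := b) hb
  have hbb : Real.pi ^ 2 / (Real.pi ^ 2 / b) = b := by
    have := Real.pi_ne_zero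
    field_simp
  rw [hbb] at h
  refine ⟨P₂, hd₂.trans (hd.trans hd₁), ?_⟩
  have hint := integrable_polyGauss K hb
  have hinv₀ : 𝓕⁻ (𝓕 (polyGauss K b)) = polyGauss K b :=
    (continuous_polyGauss K b).fourierInv_fourier_eq hint (h₁ ▸ integrable_polyGauss P₁ hb')
  have hneg : ∀ x, polyGauss P b x = polyGauss K b (-x) := fun x =>
    calc polyGauss P b x = 𝓕 (𝓕 (polyGauss K b)) x := by rw [h₁, h]
      _ = 𝓕⁻ (𝓕 (polyGauss K b)) (-x) := by rw [Real.fourierInv_eq_fourier_neg, neg_neg]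
      _ = polyGauss K b (-x) := by rw [hinv₀]
  have hinv : polyGauss P₂ (Real.pi ^ 2 / b) = 𝓕⁻ (polyGauss K b) := by
    ext w
    rw [← h₂, Real.fourierInv_eq_fourier_neg, Real.fourier_eq, Real.fourier_eq,
      ← integral_neg_eq_self]
    refine integral_congr_ae (ae_of_all _ fun x => ?_)
    simp [hneg]
  rw [hinv, (continuous_polyGauss K b).fourier_fourierInv_eq hint
    (h₁ ▸ integrable_polyGauss P₁ hb')]

/-- If the Fourier transform of `e^{-π|x|²} f(x)` is a polynomial times a Gaussian, then `f` is a
polynomial times a Gaussian, possibly with a negative exponent. -/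
lemma exists_ae_eq_polyGauss (hf : MemLp f 2) {K : MvPolynomial (Fin 2) ℂ} {β : ℝ} (hβ : 0 < β)
    (h : ∀ y, gaussFourier f 1 y = polyGauss K β y) :
    ∃ P : MvPolynomial (Fin 2) ℂ, P.totalDegree ≤ K.totalDegree ∧ (K = 0 → P = 0) ∧
      f =ᵐ[volume] polyGauss P (Real.pi ^ 2 / β - Real.pi) := by
  have hmain : ∀ P : MvPolynomial (Fin 2) ℂ, 𝓕 (polyGauss P (Real.pi ^ 2 / β)) = polyGauss K β →
      f =ᵐ[volume] polyGauss P (Real.pi ^ 2 / β - Real.pi) := by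
    intro P hP
    have hb' : 0 < Real.pi ^ 2 / β := by positivity
    filter_upwards [ae_eq_of_fourier_eq (integrable_gaussian_mul hf) (memLp_gaussian_mul hf)
      (integrable_polyGauss P hb') (memLp_polyGauss P hb') (by
        rw [hP]
        ext y
        rw [← h, ← Complex.ofReal_one, gaussFourier_ofReal, one_smul])] with x hx
    have h1 : (Real.exp (Real.pi * ‖x‖ ^ 2) : ℂ) * (Real.exp (-(Real.pi * ‖x‖ ^ 2)) : ℂ) = 1 := by
      rw [← Complex.ofReal_mul, ← Real.exp_add]
      simp
    rw [← one_mul (f x), ← h1, mul_assoc, hx, polyGauss, polyGauss, mul_left_comm,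
      ← Complex.ofReal_mul, ← Real.exp_add]
    congr 3
    ring
  by_cases hK : K = 0
  · refine ⟨0, by simp, fun _ => rfl, hmain 0 ?_⟩
    have h0 : ∀ b, polyGauss 0 b = 0 := fun b => by ext x; simp [polyGauss]
    rw [hK, h0, h0]
    ext w
    simp [Real.fourier_eq]
  · obtain ⟨P, hd, hP⟩ := exists_polyGauss_fourier_eq K hβ
    exact ⟨P, hd, fun h => absurd h hK, hmain P hP⟩

/-- A nonzero polynomial times `e^{-a|x|²}` is square integrable only if `a > 0`. -/
lemma pos_of_memLp_polyGauss {P : MvPolynomial (Fin 2) ℂ} (hP : P ≠ 0) {a : ℝ}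
    (h : MemLp (polyGauss P a) 2) : 0 < a := by
  by_contra! ha
  have hi := (memLp_two_iff_integrable_sq_norm h.1).1 h
  have h1 := totalDegree_lt_of_lintegral_lt_top hP (ζ := 1) (by simp) le_rfl (by
    refine lt_of_le_of_lt (lintegral_mono fun y => ?_) hi.lintegral_lt_top
    refine ENNReal.ofReal_le_ofReal ?_
    rw [Real.rpow_zero, div_one, polyGauss, norm_mul, Complex.norm_real,
      Real.norm_of_nonneg (Real.exp_nonneg _), mul_pow]
    simp only [one_mul]
    rw [← sq]
    refine le_mul_of_one_le_right (by positivity) (one_le_pow₀ ?_)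
    rw [Real.one_le_exp_iff]
    nlinarith [sq_nonneg ‖y‖])
  have : (0 : ℝ) ≤ P.totalDegree := Nat.cast_nonneg _
  linarith

end

/-! ### Beurling's theorem for complex-valued functions -/

/-- The Gaussian factors of the Fourier transforms of all components, on all lines, have the same
real exponent, which is positive. -/
lemma exists_common_exponent {ι : Type*} [Finite ι] {g : ι → Plane → ℂ} {u : Plane → ℝ} {d : ℝ}
    (hd : 0 ≤ d) (hg : ∀ m, MemLp (g m) 2) (hu : MemLp u 2) (hum : Measurable u)
    (hgu : ∀ m x, ‖g m x‖ ≤ u x)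
    (hB : ∀ m, BeurlingCondition d u
      fun t => ‖(𝓕 ((hg m).toLp (g m)) : Lp ℂ 2 (volume : Measure Plane)) t‖) :
    ∃ β : ℝ, 0 < β ∧ ∃ N : ℕ, ∀ m, ∀ ω : Plane, ‖ω‖ = 1 → ∃ Q : Polynomial ℂ, Q.natDegree ≤ N ∧
      ∀ z, gaussFourier (g m) z ω = Q.eval z * Complex.exp (-(β * z ^ 2)) := by
  classical
  cases nonempty_fintype ι
  by_cases hzero : ∀ m, ∀ ω : Plane, ‖ω‖ = 1 → ∀ z, gaussFourier (g m) z ω = 0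
  · exact ⟨1, one_pos, 0, fun m ω hω => ⟨0, by simp, by simpa using hzero m ω hω⟩⟩
  push Not at hzero
  obtain ⟨m₀, ω₀, hω₀, z₀, hz₀⟩ := hzero
  have hu0 : ∀ x, 0 ≤ u x := fun x => (norm_nonneg _).trans (hgu m₀ x)
  choose C hC using fun m =>
    exists_norm_gaussFourier_mul_majorant_le hd (hg m) hu hum hu0 rfl (hB m)
  have hC0 : ∀ m, 0 ≤ C m := fun m => by
    have h1 := hC m 0
    have h2 := mul_nonneg (norm_nonneg (gaussFourier (g m) 1 0)) (gaussMajorant_nonneg hu0 ‖(0:Plane)‖)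
    simpa using h2.trans h1
  set C' := ∑ m, C m with hC'
  set N := ⌈d⌉₊ with hN
  have hCN : ∀ m y, ‖gaussFourier (g m) 1 y‖ * gaussMajorant u ‖y‖ ≤ C' * (1 + ‖y‖) ^ N := by
    intro m y
    refine (hC m y).trans ?_
    have h1 : C m ≤ C' := Finset.single_le_sum (fun i _ => hC0 i) (Finset.mem_univ m)
    have h2 : (1 + ‖y‖) ^ d ≤ (1 + ‖y‖) ^ N := by
      rw [← Real.rpow_natCast]
      exact Real.rpow_le_rpow_of_exponent_le (by linarith [norm_nonneg y]) (Nat.le_ceil d)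
    exact mul_le_mul h1 h2 (by positivity) ((hC0 m).trans h1)
  have hC'0 : 0 ≤ C' := Finset.sum_nonneg fun i _ => hC0 i
  choose! Q b hQ hQe using fun m (ω : Plane) (hω : ‖ω‖ = 1) =>
    exists_gaussFourier_eq_polynomial_mul_exp (hg m).1 hu hu0 (hgu m) (hCN m) hω
  have hcmp : ∀ m ω, ‖ω‖ = 1 → ∀ m' ω', ‖ω'‖ = 1 → ∀ z : ℂ,
      ‖(Q m ω).eval z * Complex.exp (-(b m ω * z ^ 2))‖ *
        ‖(Q m' ω').eval (z.im : ℂ) * Complex.exp (-(b m' ω' * (z.im : ℂ) ^ 2))‖ ≤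
      C' * (1 + ‖z‖) ^ N := by
    intro m ω hω m' ω' hω' z
    rw [← hQe m ω hω, ← hQe m' ω' hω']
    have h1 : ‖gaussFourier (g m) z ω‖ ≤ gaussMajorant u |z.im| := by
      simpa [hω] using norm_gaussFourier_le hu (hgu m) z ω
    have h2 : ‖gaussFourier (g m') (z.im : ℂ) ω'‖ * gaussMajorant u |z.im| ≤
        C' * (1 + |z.im|) ^ N := by
      have := hCN m' (z.im • ω')
      rw [gaussFourier_smul, one_mul] at this
      simpa [norm_smul, hω'] using this
    calc _ ≤ gaussMajorant u |z.im| * ‖gaussFourier (g m') (z.im : ℂ) ω'‖ := by gcongr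
      _ = ‖gaussFourier (g m') (z.im : ℂ) ω'‖ * gaussMajorant u |z.im| := mul_comm _ _
      _ ≤ C' * (1 + |z.im|) ^ N := h2
      _ ≤ C' * (1 + ‖z‖) ^ N := by
        have := Complex.abs_im_le_norm z
        gcongr
  have hQ₀ : Q m₀ ω₀ ≠ 0 := by
    intro h
    have := hQe m₀ ω₀ hω₀ z₀
    rw [h] at this
    simp at this
    exact hz₀ this
  have him : (b m₀ ω₀).im = 0 :=
    (exponent_eq_of_norm_mul_norm_le hQ₀ hQ₀ (hcmp m₀ ω₀ hω₀ m₀ ω₀ hω₀)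
      (hcmp m₀ ω₀ hω₀ m₀ ω₀ hω₀)).1
  set β := (b m₀ ω₀).re with hβ
  have hbβ : b m₀ ω₀ = β := Complex.ext (by simp [hβ]) (by simp [him])
  refine ⟨β, ?_, N, fun m ω hω => ⟨Q m ω, hQ m ω hω, fun z => ?_⟩⟩
  · -- otherwise the transform does not tend to `0` along the line through `ω₀`
    by_contra! hβ0
    obtain ⟨ε, hε, hQε⟩ := Polynomial.exists_le_norm_eval hQ₀
    have ht := (tendsto_gaussFourier_atTop (f := g m₀) hω₀).norm
    rw [norm_zero] at ht
    obtain ⟨r, hr1, hr2⟩ := (hQε.and (ht.eventually_lt_const hε)).exists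
    rw [hQe m₀ ω₀ hω₀, norm_mul, hbβ] at hr2
    have h1 : 1 ≤ ‖Complex.exp (-(β * (r : ℂ) ^ 2))‖ := by
      rw [Complex.norm_exp, Real.one_le_exp_iff]
      have : (-(β * (r : ℂ) ^ 2)).re = -(β * r ^ 2) := by
        rw [← Complex.ofReal_pow, ← Complex.ofReal_mul, ← Complex.ofReal_neg, Complex.ofReal_re]
      rw [this]
      nlinarith [sq_nonneg r]
    nlinarith [norm_nonneg ((Q m₀ ω₀).eval (r : ℂ))]
  · by_cases hQm : Q m ω = 0
    · rw [hQe m ω hω, hQm]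
      simp
    · have := (exponent_eq_of_norm_mul_norm_le hQ₀ hQm (hcmp m₀ ω₀ hω₀ m ω hω)
        (hcmp m ω hω m₀ ω₀ hω₀)).2
      rw [hQe m ω hω, this, hbβ]

/-- Beurling's theorem for finitely many complex-valued functions with a common majorant: they are
polynomials of degree less than `(d - 2) / 2` times a common Gaussian. -/
theorem exists_ae_eq_polyGauss_of_beurlingCondition {ι : Type*} [Finite ι] {g : ι → Plane → ℂ}
    {u : Plane → ℝ} {d : ℝ}
    (hd : 0 ≤ d) (hg : ∀ m, MemLp (g m) 2) (hu : MemLp u 2) (hum : Measurable u)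
    (hgu : ∀ m x, ‖g m x‖ ≤ u x)
    (hB : ∀ m, BeurlingCondition d u
      fun t => ‖(𝓕 ((hg m).toLp (g m)) : Lp ℂ 2 (volume : Measure Plane)) t‖) :
    ∃ a : ℝ, 0 < a ∧ ∃ P : ι → MvPolynomial (Fin 2) ℂ, ∀ m,
      (P m ≠ 0 → 2 * ((P m).totalDegree : ℝ) + 2 < d) ∧ g m =ᵐ[volume] polyGauss (P m) a := by
  obtain ⟨β, hβ, N, h⟩ := exists_common_exponent hd hg hu hum hgu hB
  choose K hK using fun m => exists_gaussFourier_eq_mvPolynomial_mul_exp (hg m).1 hu (hgu m) (h m)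
  have hK1 : ∀ m y, gaussFourier (g m) 1 y = polyGauss (K m) β y := by
    intro m y
    rw [hK, polyGauss]
    push_cast
    simp
  have hdeg : ∀ m, K m ≠ 0 → 2 * ((K m).totalDegree : ℝ) + 2 < d := by
    intro m hm
    refine totalDegree_lt_of_lintegral_lt_top hm Complex.norm_I hd ?_
    refine lt_of_le_of_lt (le_of_eq ?_)
      (lintegral_gaussFourier_mul_lt_top hd (hg m) hum (hgu m) rfl (hB m))
    refine lintegral_congr fun y => ?_
    -- the Gaussian factors at `y` and at `iy` cancel
    have h1 : Complex.exp (-(β * 1 ^ 2 * (‖y‖ ^ 2 : ℝ))) *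
        Complex.exp (-(β * Complex.I ^ 2 * (‖y‖ ^ 2 : ℝ))) = 1 := by
      rw [← Complex.exp_add, Complex.I_sq]
      simp
    have h2 := congrArg norm h1
    rw [norm_mul, norm_one] at h2
    rw [hK m 1, hK m Complex.I, norm_mul, norm_mul, mul_mul_mul_comm, h2, mul_one]
    simp
  choose P hPd hP0 hP using fun m => exists_ae_eq_polyGauss (hg m) hβ (hK1 m)
  have hPdeg : ∀ m, P m ≠ 0 → 2 * ((P m).totalDegree : ℝ) + 2 < d := by
    intro m hm
    have h1 := hdeg m fun h => hm (hP0 m h)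
    have h2 : ((P m).totalDegree : ℝ) ≤ (K m).totalDegree := by exact_mod_cast hPd m
    linarith
  by_cases hz : ∀ m, P m = 0
  · refine ⟨1, one_pos, P, fun m => ⟨hPdeg m, ?_⟩⟩
    filter_upwards [hP m] with x hx
    rw [hx, hz m]
    simp [polyGauss]
  · push Not at hz
    obtain ⟨m₀, hm₀⟩ := hz
    exact ⟨_, pos_of_memLp_polyGauss hm₀ ((memLp_congr_ae (hP m₀)).1 (hg m₀)), P,
      fun m => ⟨hPdeg m, hP m⟩⟩

/-! ### Quaternion-valued functions -/

/-- The quaternion units `1, i, j, k`. -/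
def quatUnit (m : Fin 4) : ℍ[ℝ] := ![⟨1, 0, 0, 0⟩, ⟨0, 1, 0, 0⟩, ⟨0, 0, 1, 0⟩, ⟨0, 0, 0, 1⟩] m

lemma sum_component_smul_quatUnit (q : ℍ[ℝ]) : ∑ m, component q m • quatUnit m = q := by
  rw [Fin.sum_univ_four]
  ext
  · change q.re * 1 + q.imI * 0 + q.imJ * 0 + q.imK * 0 = q.re
    ring
  · change q.re * 0 + q.imI * 1 + q.imJ * 0 + q.imK * 0 = q.imI
    ring
  · change q.re * 0 + q.imI * 0 + q.imJ * 1 + q.imK * 0 = q.imJ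
    ring
  · change q.re * 0 + q.imI * 0 + q.imJ * 0 + q.imK * 1 = q.imK
    ring

/-- The quaternion polynomial whose components are the real parts of complex polynomials on the
real plane. -/
def quatPolyOfComponents (P : Fin 4 → MvPolynomial (Fin 2) ℂ) : QuatPoly :=
  ∑ m, ∑ s ∈ (P m).support, Finsupp.single (s 0, s 1) (((P m).coeff s).re • quatUnit m)

lemma quatPolyOfComponents_eval (P : Fin 4 → MvPolynomial (Fin 2) ℂ) (x : Plane) :
    (quatPolyOfComponents P).eval x =
      ∑ m, ((P m).eval fun j => (x j : ℂ)).re • quatUnit m := by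
  have h : ∀ R : QuatPoly, R.eval x = Finsupp.liftAddHom (fun m : ℕ × ℕ =>
      DistribSMul.toAddMonoidHom ℍ[ℝ] (x 0 ^ m.1 * x 1 ^ m.2)) R := fun R => rfl
  rw [h, quatPolyOfComponents, map_sum]
  refine Finset.sum_congr rfl fun m _ => ?_
  rw [map_sum, MvPolynomial.eval_eq', Complex.re_sum, Finset.sum_smul]
  refine Finset.sum_congr rfl fun s _ => ?_
  rw [Finsupp.liftAddHom_apply_single, DistribSMul.toAddMonoidHom_apply, smul_smul, Fin.prod_univ_two]
  congr 1
  rw [← Complex.ofReal_pow, ← Complex.ofReal_pow, ← Complex.ofReal_mul, Complex.re_mul_ofReal,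
    mul_comm]

lemma quatPolyOfComponents_degreeLT {P : Fin 4 → MvPolynomial (Fin 2) ℂ} {r : ℝ}
    (h : ∀ m, P m ≠ 0 → ((P m).totalDegree : ℝ) < r) : (quatPolyOfComponents P).DegreeLT r := by
  classical
  intro p hp
  obtain ⟨m, -, hp⟩ := Finset.mem_biUnion.1 (Finsupp.support_finsetSum hp)
  obtain ⟨s, hs, hp⟩ := Finset.mem_biUnion.1 (Finsupp.support_finsetSum hp)
  have hps : p = (s 0, s 1) := Finset.mem_singleton.1 (Finsupp.support_single_subset hp)
  have hm : P m ≠ 0 := by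
    rintro h0
    simp [h0] at hs
  refine lt_of_le_of_lt ?_ (h m hm)
  have h1 := MvPolynomial.le_totalDegree hs
  rw [Finsupp.sum_fintype _ _ (fun _ => rfl), Fin.sum_univ_two] at h1
  rw [hps]
  exact_mod_cast h1

/-- The integral hypothesis of Beurling's theorem passes to each pair consisting of the modulus
of a function and the complex Fourier transform of one of its components. -/
lemma beurlingCondition_component {f f' : Plane → ℍ[ℝ]} (hf : MemLp f 2) (hf' : MemLp f' 2)
    (hff' : f =ᵐ[volume] f') {d : ℝ}
    (hint : (∫⁻ y : Plane, ∫⁻ x : Plane,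
      ENNReal.ofReal (‖f x‖ * qftModulus f y / (1 + ‖x‖ + ‖y‖) ^ d *
        Real.exp (2 * Real.pi * ‖x‖ * ‖y‖))) < ∞) (m : Fin 4) :
    BeurlingCondition d (fun x => ‖f' x‖)
      fun t => ‖(𝓕 ((memLp_component hf' m).toLp _) : Lp ℂ 2 (volume : Measure Plane)) t‖ := by
  have hLp : (memLp_component hf' m).toLp _ = (memLp_component hf m).toLp _ :=
    MemLp.toLp_congr _ _ (hff'.mono fun x hx => by dsimp only; rw [hx])
  rw [hLp]
  have hle : ∀ᵐ t : Plane, ∫⁻ x : Plane, ENNReal.ofReal (‖f' x‖ *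
      ‖(𝓕 ((memLp_component hf m).toLp _) : Lp ℂ 2 (volume : Measure Plane)) t‖ *
        beurlingWeight d x t) ≤ ENNReal.ofReal √2 * ∫⁻ x : Plane,
      ENNReal.ofReal (‖f x‖ * qftModulus f t / (1 + ‖x‖ + ‖t‖) ^ d *
        Real.exp (2 * Real.pi * ‖x‖ * ‖t‖)) := by
    filter_upwards [norm_fourier_component_le hf m] with t ht
    rw [← lintegral_const_mul' _ _ ENNReal.ofReal_ne_top]
    refine lintegral_mono_ae ?_
    filter_upwards [hff'] with x hx
    rw [← ENNReal.ofReal_mul (Real.sqrt_nonneg 2), ← hx]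
    refine ENNReal.ofReal_le_ofReal ?_
    calc _ ≤ ‖f x‖ * (√2 * qftModulus f t) * beurlingWeight d x t := by
          have := beurlingWeight_nonneg d x t
          gcongr
      _ = _ := by rw [beurlingWeight]; ring
  refine lt_of_le_of_lt (lintegral_mono_ae hle) ?_
  rw [lintegral_const_mul' _ _ ENNReal.ofReal_ne_top]
  exact ENNReal.mul_lt_top ENNReal.ofReal_lt_top hint

/-- A square integrable quaternion-valued function `f` satisfying Beurling's condition is a
polynomial of degree less than `(d - 2) / 2` times a Gaussian. -/
theorem exists_ae_eq_exp_smul_quatPoly {f : Plane → ℍ[ℝ]} (hf : MemLp f 2) {d : ℝ} (hd : 0 ≤ d)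
    (hint : (∫⁻ y : Plane, ∫⁻ x : Plane,
      ENNReal.ofReal (‖f x‖ * qftModulus f y / (1 + ‖x‖ + ‖y‖) ^ d *
        Real.exp (2 * Real.pi * ‖x‖ * ‖y‖))) < ∞) :
    ∃ (a : ℝ) (P : QuatPoly), 0 < a ∧ P.DegreeLT ((d - 2) / 2) ∧
      ∀ᵐ x : Plane, f x = Real.exp (-(a * ‖x‖ ^ 2)) • P.eval x := by
  -- a measurable representative, whose modulus bounds its components everywhere
  set f' := hf.1.mk f
  have hff' : f =ᵐ[volume] f' := hf.1.ae_eq_mk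
  have hf' : MemLp f' 2 := (memLp_congr_ae hff').1 hf
  obtain ⟨a, ha, P, hP⟩ := exists_ae_eq_polyGauss_of_beurlingCondition hd
    (memLp_component hf') hf'.norm hf.1.stronglyMeasurable_mk.norm.measurable
    (fun m x => by simpa using abs_component_le (f' x) m)
    (beurlingCondition_component hf hf' hff' hint)
  refine ⟨a, quatPolyOfComponents P, ha, quatPolyOfComponents_degreeLT fun m hm => ?_, ?_⟩
  · have := (hP m).1 hm
    linarith
  · filter_upwards [hff', ae_all_iff.2 fun m => (hP m).2] with x hx hx'
    rw [hx, ← sum_component_smul_quatUnit (f' x), quatPolyOfComponents_eval, Finset.smul_sum]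
    refine Finset.sum_congr rfl fun m _ => ?_
    rw [smul_smul]
    congr 1
    have h1 := congrArg Complex.re (hx' m)
    rw [polyGauss, Complex.re_mul_ofReal, Complex.ofReal_re] at h1
    rw [h1, mul_comm]

end TwoSidedQFT

end

theorem theorem4p2 (f : TwoSidedQFT.Plane → ℍ[ℝ]) (hf : MemLp f 2 volume) (d : ℝ) (hd : 0 ≤ d)
    (hint : (∫⁻ y : TwoSidedQFT.Plane, ∫⁻ x : TwoSidedQFT.Plane,
      ENNReal.ofReal (‖f x‖ * TwoSidedQFT.qftModulus f y / (1 + ‖x‖ + ‖y‖) ^ d *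
        Real.exp (2 * Real.pi * ‖x‖ * ‖y‖))) < ∞) :
    (∃ (a : ℝ) (P : TwoSidedQFT.QuatPoly), 0 < a ∧ P.DegreeLT ((d - 2) / 2) ∧
      ∀ᵐ x : TwoSidedQFT.Plane, f x = Real.exp (-(a * ‖x‖ ^ 2)) • P.eval x) ∧
    (d ≤ 2 → ∀ᵐ x : TwoSidedQFT.Plane, f x = 0) := by
  have main := TwoSidedQFT.exists_ae_eq_exp_smul_quatPoly hf hd hint
  refine ⟨main, fun hd2 => ?_⟩
  obtain ⟨a, P, -, hdeg, hP⟩ := main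
  have hP0 : P = 0 := by
    refine Finsupp.support_eq_empty.1 (Finset.eq_empty_of_forall_notMem fun p hp => ?_)
    have h1 := hdeg p hp
    have h2 : (0 : ℝ) ≤ ((p.1 + p.2 : ℕ) : ℝ) := Nat.cast_nonneg _
    linarith
  filter_upwards [hP] with x hx
  rw [hx, hP0]
  simp [TwoSidedQFT.QuatPoly.eval]
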